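/- Let $k$ be an algebraically closed field of arbitrary characteristic, let $n\ge 0$, and let $H$ be an $n$-step iterated Hopf Ore extension (IHOE) of $k$ with defining variables $X_1,\dots,X_n$. This means that $H$ is a Hopf $k$-algebra generated as an algebra by $X_1,\dots,X_n$ such that, writing $H_{(i)}=k\langle X_1,\dots,X_i\rangle$ (so $H_{(0)}=k$ and $H_{(n)}=H$), each $H_{(i)}$ is a Hopf subalgebra of $H$, and for each $i=1,\dots,n$ there are a $k$-algebra automorphism $\sigma_i$ of $H_{(i-1)}$ and a $k$-linear $\sigma_i$-derivation $\delta_i$ of $H_{(i-1)}$ (that is, $\delta_i(ab)=\sigma_i(a)\delta_i(b)+\delta_i(a)b$) with $H_{(i)}=H_{(i-1)}[X_i;\sigma_i,\delta_i]$; that is, $X_i r=\sigma_i(r)X_i+\delta_i(r)$ for all $r\in H_{(i-1)}$, and $H_{(i)}$ is a free left $H_{(i-1)}$-module with basis $1,X_i,X_i^2,\dots$. Then the ordered monomials $X^m=X_1^{m_1}\cdots X_n^{m_n}$ with $m\in\mathbb Z_{\ge0}^n$ form a $k$-basis of $H$ (the PBW basis), and there are positive integers $d_1,\dots,d_n$ with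 the following properties. For $\alpha\in H$ let $\deg\alpha$ be the maximum of $\sum_i m_i d_i$ over the basis monomials $X^m$ that occur with non-zero coefficient in $\alpha$ (with $\deg 0=0$), and for $r\ge0$ let $\mathcal C_r=\{\alpha\in H:\deg\alpha\le r\}$. Then: 1. $(\mathcal C_r)_{r\ge0}$ is an exhaustive algebra filtration of $H$: it is increasing, $1\in\mathcal C_0$, $\mathcal C_r\mathcal C_s\subseteq\mathcal C_{r+s}$ for all $r,s\ge 0$, and $\bigcup_r\mathcal C_r=H$. 2. The associated graded algebra $\operatorname{gr}_{\mathcal C}H=\bigoplus_{r\ge0}\mathcal C_r/\mathcal C_{r-1}$ (with $\mathcal C_{-1}=0$) is the commutative polynomial algebra in $n$ variables: there is a $k$-algebra isomorphism $\operatorname{gr}_{\mathcal C}H\cong k[x_1,\dots,x_n]$ that sends the class of $X_i$ in $\mathcal C_{d_i}/\mathcal C_{d_i-1}$ to $x_i$ for each $i$ and is an isomorphism of graded algebras when $x_i$ is given degree $d_i$. (In this sense $H$ is a PBW-deformation of $k[x_1,\dots,x_n]$.) -/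

import Mathlib

open scoped TensorProduct DirectSum

universe u v

/-! ### Ore extensions and iterated Hopf Ore extensions -/

/-- Inside a `k`-algebra `H`, the subalgebra `B` is the Ore extension `R[x; σ, δ]` of the
subalgebra `R`: here `σ` is an algebra automorphism of `R`, `δ` is a `k`-linear `σ`-derivation
of `R`, `x r = σ(r) x + δ(r)` for `r ∈ R`, and `B` is a free left `R`-module on
the powers `1, x, x ^ 2, …`. -/
structure IsOreExtension {k : Type u} {H : Type v} [Field k] [Ring H] [Algebra k H]
    (R B : Subalgebra k H) (x : H) (σ : R ≃ₐ[k] R) (δ : R →ₗ[k] R) : Prop where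
  le : R ≤ B
  mem : x ∈ B
  leibniz : ∀ a b : R, δ (a * b) = σ a * δ b + δ a * b
  commutation : ∀ r : R, x * (r : H) = (σ r : H) * x + (δ r : H)
  free : ∀ y ∈ B, ∃! p : ℕ →₀ R, y = p.sum fun i r => (r : H) * x ^ i

/-- A subalgebra `A` of a Hopf algebra `H` is a Hopf subalgebra: `Δ(A) ⊆ A ⊗ A` (as a subspace
of `H ⊗ H`) and `S(A) ⊆ A`. -/
structure IsHopfSubalgebra {k : Type u} {H : Type v} [Field k] [Ring H] [HopfAlgebra k H]
    (A : Subalgebra k H) : Prop where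
  comul_mem : ∀ a ∈ A, Coalgebra.comul (R := k) a ∈
    LinearMap.range (TensorProduct.map A.val.toLinearMap A.val.toLinearMap)
  antipode_mem : ∀ a ∈ A, HopfAlgebra.antipode k a ∈ A

/-- The subalgebra `k⟨X_1, …, X_i⟩` generated by the first `i` of the elements `X_1, …, X_n`
(which are indexed from `0`); for `i = 0` it is the image of `k`. -/
def stepSubalgebra (k : Type u) {H : Type v} [Field k] [Ring H] [Algebra k H]
    {n : ℕ} (X : Fin n → H) (i : ℕ) : Subalgebra k H :=
  Algebra.adjoin k (X '' {j : Fin n | (j : ℕ) < i})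

/-- The Hopf algebra `H` is an `n`-step iterated Hopf Ore extension of `k` with defining variables
`X_1, …, X_n`, that is `H = k[X_1][X_2; σ_2, δ_2] ⋯ [X_n; σ_n, δ_n]` where every
`k⟨X_1, …, X_i⟩` is a Hopf subalgebra. (In the first step the base is `k` itself, so that
`σ_1 = id` and `δ_1 = 0` are forced.) -/
structure IsIHOE (k : Type u) {H : Type v} [Field k] [Ring H] [HopfAlgebra k H]
    {n : ℕ} (X : Fin n → H) : Prop where
  top : stepSubalgebra k X n = ⊤
  hopf : ∀ i : ℕ, i ≤ n → IsHopfSubalgebra (stepSubalgebra k X i)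
  ore : ∀ i : Fin n, ∃ (σ : stepSubalgebra k X i ≃ₐ[k] stepSubalgebra k X i)
    (δ : stepSubalgebra k X i →ₗ[k] stepSubalgebra k X i),
    IsOreExtension (stepSubalgebra k X i) (stepSubalgebra k X (i + 1)) (X i) σ δ

/-! ### The PBW basis and the filtration defined by degrees of the variables -/

/-- The ordered monomial `X_1 ^ m_1 * X_2 ^ m_2 * ⋯ * X_n ^ m_n`. -/
def pbwMonomial {H : Type v} [Ring H] {n : ℕ} (X : Fin n → H) (m : Fin n →₀ ℕ) : H :=
  (List.ofFn fun i => X i ^ m i).prod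

/-- The degree of `α` for the degrees `d_1, …, d_n` of the variables: the maximum of
`∑ m_i d_i` over the basis elements `b m` that occur in `α` (and `0` for `α = 0`). -/
noncomputable def pbwDegree {k : Type u} {H : Type v} [Field k] [Ring H] [Algebra k H] {n : ℕ}
    (b : Module.Basis (Fin n →₀ ℕ) k H) (d : Fin n → ℕ) (α : H) : ℕ :=
  (b.repr α).support.sup fun m => ∑ i, m i * d i

/-- The subspace `{α | deg α ≤ r}`. -/
noncomputable def pbwFiltration {k : Type u} {H : Type v} [Field k] [Ring H] [Algebra k H] {n : ℕ}
    (b : Module.Basis (Fin n →₀ ℕ) k H) (d : Fin n → ℕ) (r : ℕ) : Submodule k H where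
  carrier := {α | pbwDegree b d α ≤ r}
  zero_mem' := by simp [pbwDegree]
  add_mem' := by
    classical
    intro x y hx hy
    simp only [pbwDegree, Set.mem_ofPred_eq, Finset.sup_le_iff] at hx hy ⊢
    intro m hm
    rw [map_add] at hm
    rcases Finset.mem_union.1 (Finsupp.support_add hm) with h | h
    · exact hx m h
    · exact hy m h
  smul_mem' := by
    intro c x hx
    simp only [pbwDegree, Set.mem_ofPred_eq, Finset.sup_le_iff] at hx ⊢
    intro m hm
    rw [map_smul] at hm
    exact hx m (Finsupp.support_smul hm)

/-! ### The associated graded algebra of a filtered algebra -/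

section AssociatedGraded

variable {k : Type u} {H : Type v} [Field k] [Ring H] [Algebra k H]

/-- The sum of the terms of a filtration of index less than `i`
(it is `C (i - 1)` for `i > 0` and `0` for `i = 0`). -/
def filtrationLT (C : ℕ → Submodule k H) (i : ℕ) : Submodule k H :=
  ⨆ j : ℕ, ⨆ _ : j < i, C j

/-- The `i`-th component `C_i / C_{i-1}` of the associated graded algebra. -/
abbrev GrPiece (C : ℕ → Submodule k H) (i : ℕ) : Type v :=
  C i ⧸ (filtrationLT C i).comap (C i).subtype

/-- The class in `C_i / C_{i-1}` of an element of `C_i`. -/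
def grMk (C : ℕ → Submodule k H) (i : ℕ) : C i →ₗ[k] GrPiece C i :=
  Submodule.mkQ _

variable (C : ℕ → Submodule k H)

theorem grMk_surjective (i : ℕ) : Function.Surjective (grMk C i) :=
  Submodule.mkQ_surjective _

theorem grMk_eq_zero {i : ℕ} (a : C i) : grMk C i a = 0 ↔ (a : H) ∈ filtrationLT C i := by
  simp [grMk]

theorem gradedMonoid_grMk_eq {i j : ℕ} (h : i = j) (a : C i) (b : C j) (hab : (a : H) = b) :
    (GradedMonoid.mk i (grMk C i a) : GradedMonoid (GrPiece C)) =
      GradedMonoid.mk j (grMk C j b) := by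
  subst h
  rw [Subtype.ext hab]

variable [hC : IsRingFiltration C (filtrationLT C)]

theorem mul_mem_filtrationLT_left {i j : ℕ} {a c : H} (ha : a ∈ filtrationLT C i)
    (hc : c ∈ C j) : a * c ∈ filtrationLT C (i + j) := by
  have key : filtrationLT C i ≤ (filtrationLT C (i + j)).comap (LinearMap.mulRight k c) := by
    refine iSup₂_le fun l hl x hx => ?_
    exact hC.is_le (Nat.add_lt_add_right hl j) (SetLike.mul_mem_graded hx hc)
  exact key ha

theorem mul_mem_filtrationLT_right {i j : ℕ} {a c : H} (ha : a ∈ C i)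
    (hc : c ∈ filtrationLT C j) : a * c ∈ filtrationLT C (i + j) := by
  have key : filtrationLT C j ≤ (filtrationLT C (i + j)).comap (LinearMap.mulLeft k a) := by
    refine iSup₂_le fun l hl x hx => ?_
    exact hC.is_le (Nat.add_lt_add_left hl i) (SetLike.mul_mem_graded ha hx)
  exact key hc

/-- The multiplication `C_i × C_j → C_{i+j}`. -/
def filtrationMul (i j : ℕ) : C i →ₗ[k] C j →ₗ[k] C (i + j) :=
  LinearMap.mk₂ k (fun a c => ⟨(a : H) * c, SetLike.mul_mem_graded a.2 c.2⟩)
    (fun _ _ _ => Subtype.ext (add_mul _ _ _))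
    (fun _ _ _ => Subtype.ext (smul_mul_assoc _ _ _))
    (fun _ _ _ => Subtype.ext (mul_add _ _ _))
    (fun _ _ _ => Subtype.ext (mul_smul_comm _ _ _))

/-- The multiplication `C_i / C_{i-1} × C_j / C_{j-1} → C_{i+j} / C_{i+j-1}` induced by
that of `H`. -/
def grMul (i j : ℕ) : GrPiece C i →ₗ[k] GrPiece C j →ₗ[k] GrPiece C (i + j) :=
  Submodule.liftQ _
    { toFun := fun a => Submodule.liftQ _ ((grMk C (i + j)).comp (filtrationMul C i j a)) (by
        intro c hc
        exact (grMk_eq_zero C _).2 (mul_mem_filtrationLT_right C a.2 hc))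
      map_add' := by
        intro a a'
        ext c
        simp only [map_add, LinearMap.comp_add]
        rfl
      map_smul' := by
        intro r a
        ext c
        simp only [map_smul, LinearMap.comp_smul]
        rfl }
    (by
      intro a ha
      ext c
      exact (grMk_eq_zero C _).2 (mul_mem_filtrationLT_left C ha c.2))

theorem grMul_grMk (i j : ℕ) (a : C i) (c : C j) :
    grMul C i j (grMk C i a) (grMk C j c) =
      grMk C (i + j) ⟨(a : H) * c, SetLike.mul_mem_graded a.2 c.2⟩ := rfl

instance grGMul : GradedMonoid.GMul (GrPiece C) where
  mul {i j} a c := grMul C i j a c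

instance grGOne : GradedMonoid.GOne (GrPiece C) where
  one := grMk C 0 ⟨1, SetLike.one_mem_graded C⟩

theorem gr_mk_mul_mk {i j : ℕ} (a : C i) (c : C j) :
    (GradedMonoid.mk i (grMk C i a) * GradedMonoid.mk j (grMk C j c) :
      GradedMonoid (GrPiece C)) =
      GradedMonoid.mk (i + j)
        (grMk C (i + j) ⟨(a : H) * c, SetLike.mul_mem_graded a.2 c.2⟩) := rfl

theorem gr_one_def :
    (1 : GradedMonoid (GrPiece C)) =
      GradedMonoid.mk 0 (grMk C 0 ⟨1, SetLike.one_mem_graded C⟩) := rfl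

instance grGRing : DirectSum.GRing (GrPiece C) where
  mul_zero := fun a => map_zero (grMul C _ _ a)
  zero_mul := fun c => by
    change grMul C _ _ 0 c = 0
    rw [map_zero, LinearMap.zero_apply]
  mul_add := fun a c c' => map_add (grMul C _ _ a) c c'
  add_mul := fun a a' c => by
    change grMul C _ _ (a + a') c = grMul C _ _ a c + grMul C _ _ a' c
    rw [map_add, LinearMap.add_apply]
  one_mul := by
    rintro ⟨i, a⟩
    obtain ⟨a, rfl⟩ := grMk_surjective C i a
    exact (gr_mk_mul_mk C _ a).trans (gradedMonoid_grMk_eq C (zero_add i) _ _ (one_mul _))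
  mul_one := by
    rintro ⟨i, a⟩
    obtain ⟨a, rfl⟩ := grMk_surjective C i a
    exact (gr_mk_mul_mk C a _).trans (gradedMonoid_grMk_eq C (add_zero i) _ _ (mul_one _))
  mul_assoc := by
    rintro ⟨i, a⟩ ⟨j, c⟩ ⟨l, e⟩
    obtain ⟨a, rfl⟩ := grMk_surjective C i a
    obtain ⟨c, rfl⟩ := grMk_surjective C j c
    obtain ⟨e, rfl⟩ := grMk_surjective C l e
    exact gradedMonoid_grMk_eq C (add_assoc i j l) ⟨(a : H) * c * e, _⟩ ⟨(a : H) * (c * e), _⟩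
      (mul_assoc _ _ _)
  natCast := fun m => m • grMk C 0 ⟨1, SetLike.one_mem_graded C⟩
  natCast_zero := zero_smul ℕ _
  natCast_succ := fun m => succ_nsmul _ m
  intCast := fun m => m • grMk C 0 ⟨1, SetLike.one_mem_graded C⟩
  intCast_ofNat := fun m => natCast_zsmul _ m
  intCast_negSucc_ofNat := fun m => negSucc_zsmul _ m

instance grGSemiring : DirectSum.GSemiring (GrPiece C) := (grGRing C).toGSemiring

instance grGAlgebra : DirectSum.GAlgebra k (GrPiece C) where
  toFun := (grMk C 0 ∘ₗ
    LinearMap.toSpanSingleton k (C 0) ⟨1, SetLike.one_mem_graded C⟩).toAddMonoidHom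
  map_one := congrArg (grMk C 0) (one_smul k _)
  map_mul := fun r s =>
    gradedMonoid_grMk_eq C (zero_add 0).symm ((r * s) • ⟨1, SetLike.one_mem_graded C⟩)
      ⟨(r • (1 : H)) * (s • (1 : H)), _⟩ (by simp [mul_smul, smul_comm r s])
  commutes := by
    rintro r ⟨i, a⟩
    obtain ⟨a, rfl⟩ := grMk_surjective C i a
    exact gradedMonoid_grMk_eq C (Nat.add_comm 0 i) ⟨(r • (1 : H)) * a, _⟩
      ⟨(a : H) * (r • (1 : H)), _⟩ (by simp)
  smul_def := by
    rintro r ⟨i, a⟩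
    obtain ⟨a, rfl⟩ := grMk_surjective C i a
    exact gradedMonoid_grMk_eq C (zero_add i).symm (r • a) ⟨(r • (1 : H)) * a, _⟩ (by simp)

end AssociatedGraded

/-- The associated graded algebra `⨁ C_i / C_{i-1}` of a filtration `C`; for an algebra
filtration it is a `k`-algebra. -/
abbrev Gr {k : Type u} {H : Type v} [Field k] [Ring H] [Algebra k H]
    (C : ℕ → Submodule k H) : Type v :=
  ⨁ i, GrPiece C i

/-- The homogeneous element of degree `i` of the associated graded algebra that is
given by the class of `a ∈ C_i` modulo `C_{i-1}`. -/
def grSymbol {k : Type u} {H : Type v} [Field k] [Ring H] [Algebra k H]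
    (C : ℕ → Submodule k H) (i : ℕ) (a : C i) : Gr C :=
  DirectSum.of (GrPiece C) i (grMk C i a)

/-! The weights are chosen so that the variables commute up to terms of lower weight. Ordered
monomials then multiply like commuting ones up to lower weight (`IsPBWDeformation`), and passing to
the part of top weight (`pbwSymbol`) identifies the associated graded algebra with the polynomial
ring. For a step `B = R[x; σ, δ]` this asks that `δ(X_l)` weigh less than `X_l x`, which holds once
`x` is heavy enough, and that `σ(X_l) - X_l` weigh less than `X_l`. The second condition is where
the Hopf structure enters.

The key fact is `Δ(x) = w + x ⊗ 1 + 1 ⊗ x` with `w ∈ R ⊗ R` (`IsOreHom.comul_variable`).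
Coassociativity and a degree count in `B ⊗ B ⊗ B` bound the degree of `Δ(x)` by one in each factor
(`mem_oreDegLT_two_of_map_eq`), so `Δ(x) = w + t (x ⊗ 1) + s (1 ⊗ x) + v (x ⊗ x)`. Comparing
coefficients makes `v` a multiplicative two-cocycle (`IsOreHom.comul_coeff_relations`). The
variables of `R` are primitive up to lower weight, so the symbol of `v`, if `v ≠ 0`, is a polynomial
two-cocycle of the additive group; it does not vanish at the origin
(`constantCoeff_ne_zero_of_cocycle`), so `v` is a scalar. A non-zero `v` would produce a group-like
element of degree one in `x`, hence a unit of positive degree, which is impossible. With `v = 0`,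
weights force `t` and `s` to be scalars, and the counit makes them `1`.

Applying `Δ` to `x r = σ(r) x + δ(r)` now gives `σ(r) = (χ ⊗ id) Δ(r)` for a character `χ`
(`IsOreHom.exists_winding`). Since `X_l` is primitive modulo the tensor square of the algebra of
earlier variables, `σ(X_l) - X_l` lies in that algebra.

So each weight `d_l` has to dominate finitely many elements in earlier variables, some of which
appear only at later steps. The induction hypothesis `HasWeights` therefore allows arbitrary finite
sets to be prescribed in advance; the factor one half in it serves the products `p ⊗ q` that make up
`w`. -/

/-! ### Ore extensions along algebra homomorphisms -/

section OreHom

variable {k : Type*} [Field k] {R B T : Type*} [Ring R] [Algebra k R] [Ring B] [Algebra k B]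
  [Ring T] [Algebra k T]

/-- The linear map `∑ r_i t ^ i ↦ ∑ j(r_i) x ^ i`. -/
noncomputable def oreSum (j : R →ₐ[k] B) (x : B) : (ℕ →₀ R) →ₗ[k] B :=
  Finsupp.lsum k fun i => (LinearMap.mulRight k (x ^ i)).comp j.toLinearMap

theorem oreSum_single (j : R →ₐ[k] B) (x : B) (i : ℕ) (r : R) :
    oreSum j x (Finsupp.single i r) = j r * x ^ i := by
  simp [oreSum]

theorem oreSum_apply (j : R →ₐ[k] B) (x : B) (p : ℕ →₀ R) :
    oreSum j x p = p.sum fun i r => j r * x ^ i := rfl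

/-- The algebra homomorphism `j : R → B` exhibits `B` as the Ore extension `R[x; σ, δ]`. -/
structure IsOreHom (j : R →ₐ[k] B) (x : B) (σ : R ≃ₐ[k] R) (δ : R →ₗ[k] R) : Prop where
  comm : ∀ r, x * j r = j (σ r) * x + j (δ r)
  bij : Function.Bijective (oreSum j x)

/-- The elements of degree less than `n` in the variable `x`. -/
def oreDegLT (j : R →ₐ[k] B) (x : B) (n : ℕ) : Submodule k B :=
  Submodule.span k {y | ∃ i < n, ∃ r, y = j r * x ^ i}

/-- `y` is the sum of `j c * x ^ n` and of terms of lower degree in `x`. -/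
def OreLead (j : R →ₐ[k] B) (x : B) (y : B) (n : ℕ) (c : R) : Prop :=
  y - j c * x ^ n ∈ oreDegLT j x n

variable {j : R →ₐ[k] B} {x : B} {σ : R ≃ₐ[k] R} {δ : R →ₗ[k] R}

theorem mul_pow_mem_oreDegLT (r : R) {i n : ℕ} (h : i < n) : j r * x ^ i ∈ oreDegLT j x n :=
  Submodule.subset_span ⟨i, h, r, rfl⟩

theorem map_mem_oreDegLT (r : R) {n : ℕ} (h : 0 < n) : j r ∈ oreDegLT j x n := by
  simpa using mul_pow_mem_oreDegLT (x := x) r h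

theorem oreDegLT_le {n : ℕ} {S : Submodule k B} (h : ∀ i < n, ∀ r, j r * x ^ i ∈ S) :
    oreDegLT j x n ≤ S := by
  refine Submodule.span_le.2 ?_
  rintro _ ⟨i, hi, r, rfl⟩
  exact h i hi r

theorem oreDegLT_mono {m n : ℕ} (h : m ≤ n) : oreDegLT j x m ≤ oreDegLT j x n :=
  oreDegLT_le fun _ hi r => mul_pow_mem_oreDegLT r (hi.trans_le h)

theorem map_mul_mem_oreDegLT (r : R) {n : ℕ} {y : B} (hy : y ∈ oreDegLT j x n) :
    j r * y ∈ oreDegLT j x n := by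
  have : oreDegLT j x n ≤ (oreDegLT j x n).comap (LinearMap.mulLeft k (j r)) := by
    refine oreDegLT_le fun i hi s => ?_
    simpa [← mul_assoc, ← map_mul] using mul_pow_mem_oreDegLT (r * s) hi
  exact this hy

theorem mul_pow_right_mem_oreDegLT {m n : ℕ} {y : B} (hy : y ∈ oreDegLT j x n) :
    y * x ^ m ∈ oreDegLT j x (n + m) := by
  have : oreDegLT j x n ≤ (oreDegLT j x (n + m)).comap (LinearMap.mulRight k (x ^ m)) := by
    refine oreDegLT_le fun i hi s => ?_
    simpa [mul_assoc, ← pow_add] using mul_pow_mem_oreDegLT s (by omega : i + m < n + m)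
  exact this hy

/-- The number `n` is at least the degree of `y` in `x`. -/
theorem mem_oreDegLT_succ_iff {n : ℕ} {y : B} :
    y ∈ oreDegLT j x (n + 1) ↔ ∃ c, OreLead j x y n c := by
  constructor
  · intro hy
    have : oreDegLT j x (n + 1) ≤ LinearMap.range
        (LinearMap.mulRight k (x ^ n) ∘ₗ j.toLinearMap) ⊔ oreDegLT j x n := by
      refine oreDegLT_le fun i hi s => ?_
      rcases Nat.lt_succ_iff_lt_or_eq.1 hi with h | rfl
      · exact Submodule.mem_sup_right (mul_pow_mem_oreDegLT s h)
      · exact Submodule.mem_sup_left ⟨s, rfl⟩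
    obtain ⟨_, ⟨c, rfl⟩, z, hz, rfl⟩ := Submodule.mem_sup.1 (this hy)
    exact ⟨c, by simpa [OreLead] using hz⟩
  · rintro ⟨c, hc⟩
    have := add_mem (oreDegLT_mono (Nat.le_succ n) hc)
      (mul_pow_mem_oreDegLT (j := j) (x := x) c (Nat.lt_succ_self n))
    simpa using this

theorem oreDegLT_zero : oreDegLT j x 0 = ⊥ := by
  rw [eq_bot_iff]
  exact oreDegLT_le fun i hi => absurd hi (Nat.not_lt_zero i)

namespace IsOreHom

theorem injective (h : IsOreHom j x σ δ) : Function.Injective j := by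
  intro a b hab
  have := @h.bij.1 (Finsupp.single 0 a) (Finsupp.single 0 b) (by simp [oreSum_single, hab])
  simpa using congrArg (fun p => p 0) this

/-- The coefficients of an element of an Ore extension. -/
noncomputable def coeff (h : IsOreHom j x σ δ) : B ≃ₗ[k] (ℕ →₀ R) :=
  (LinearEquiv.ofBijective _ h.bij).symm

theorem coeff_mul_pow (h : IsOreHom j x σ δ) (i : ℕ) (r : R) :
    h.coeff (j r * x ^ i) = Finsupp.single i r := by
  rw [coeff, LinearEquiv.symm_apply_eq, LinearEquiv.ofBijective_apply, oreSum_single]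

theorem coeff_eq_zero_of_mem (h : IsOreHom j x σ δ) {n : ℕ} {y : B} (hy : y ∈ oreDegLT j x n) :
    h.coeff y n = 0 := by
  have : oreDegLT j x n ≤ LinearMap.ker ((Finsupp.lapply n) ∘ₗ h.coeff.toLinearMap) := by
    refine oreDegLT_le fun i hi r => ?_
    simp [coeff_mul_pow, hi.ne]
  exact this hy

theorem eq_zero_of_mul_pow_mem (h : IsOreHom j x σ δ) {n : ℕ} {c : R}
    (hc : j c * x ^ n ∈ oreDegLT j x n) : c = 0 := by
  simpa [coeff_mul_pow] using h.coeff_eq_zero_of_mem hc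

theorem add_mul_inj (h : IsOreHom j x σ δ) {a b a' b' : R}
    (e : j a + j b * x = j a' + j b' * x) : a = a' ∧ b = b' := by
  have key : ∀ a b, h.coeff (j a + j b * x) = Finsupp.single 0 a + Finsupp.single 1 b := by
    intro a b
    rw [map_add, ← h.coeff_mul_pow, ← h.coeff_mul_pow]
    simp
  have e' := congrArg h.coeff e
  rw [key, key] at e'
  exact ⟨by simpa using congrArg (fun p => p 0) e', by simpa using congrArg (fun p => p 1) e'⟩

/-- The degree is one less than the least bound `n` with `y ∈ oreDegLT j x n`; minimality makes the
leading coefficient non-zero. -/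
theorem exists_lead (h : IsOreHom j x σ δ) {y : B} (hy : y ≠ 0) :
    ∃ n c, c ≠ 0 ∧ OreLead j x y n c := by
  classical
  have hex : ∃ n, y ∈ oreDegLT j x n := by
    obtain ⟨p, rfl⟩ := h.bij.2 y
    induction p using Finsupp.induction_linear with
    | zero => exact ⟨0, by simp⟩
    | add p q hp hq =>
      by_cases hp0 : oreSum j x p = 0
      · by_cases hq0 : oreSum j x q = 0
        · exact ⟨0, by simp [hp0, hq0]⟩
        · simpa [hp0] using hq hq0
      · obtain ⟨n, hn⟩ := hp hp0
        by_cases hq0 : oreSum j x q = 0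
        · exact ⟨n, by simpa [hq0] using hn⟩
        · obtain ⟨m, hm⟩ := hq hq0
          refine ⟨max n m, ?_⟩
          rw [map_add]
          exact add_mem (oreDegLT_mono (le_max_left _ _) hn) (oreDegLT_mono (le_max_right _ _) hm)
    | single i r => exact ⟨i + 1, by
        rw [oreSum_single]; exact mul_pow_mem_oreDegLT r (Nat.lt_succ_self i)⟩
  have hspec := Nat.find_spec hex
  obtain ⟨n, hn⟩ : ∃ n, Nat.find hex = n + 1 := by
    refine Nat.exists_eq_succ_of_ne_zero fun h0 => hy ?_
    rw [h0, oreDegLT_zero] at hspec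
    exact hspec
  rw [hn] at hspec
  obtain ⟨c, hc⟩ := mem_oreDegLT_succ_iff.1 hspec
  refine ⟨n, c, ?_, hc⟩
  rintro rfl
  have : y ∈ oreDegLT j x n := by simpa [OreLead] using hc
  exact Nat.find_min hex (by omega) this

theorem lead_unique (h : IsOreHom j x σ δ) {y : B} {n m : ℕ} {c e : R} (hc : OreLead j x y n c)
    (he : OreLead j x y m e) (hc0 : c ≠ 0) (he0 : e ≠ 0) : n = m := by
  have key : ∀ {n m : ℕ} {c e : R}, OreLead j x y n c → OreLead j x y m e → e ≠ 0 →
      ¬ n < m := by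
    intro n m c e hc he he0 hlt
    have h1 : y ∈ oreDegLT j x m := oreDegLT_mono hlt (mem_oreDegLT_succ_iff.2 ⟨c, hc⟩)
    have h2 := sub_mem h1 he
    rw [sub_sub_cancel] at h2
    exact he0 (h.eq_zero_of_mul_pow_mem h2)
  exact le_antisymm (not_lt.1 (key he hc hc0)) (not_lt.1 (key hc he he0))

theorem x_mul_mem (h : IsOreHom j x σ δ) {n : ℕ} {y : B} (hy : y ∈ oreDegLT j x n) :
    x * y ∈ oreDegLT j x (n + 1) := by
  have : oreDegLT j x n ≤ (oreDegLT j x (n + 1)).comap (LinearMap.mulLeft k x) := by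
    refine oreDegLT_le fun i hi s => ?_
    simp only [Submodule.mem_comap, LinearMap.mulLeft_apply]
    rw [← mul_assoc, h.comm, add_mul, mul_assoc, ← pow_succ']
    exact add_mem (mul_pow_mem_oreDegLT _ (by omega)) (mul_pow_mem_oreDegLT _ (by omega))
  exact this hy

theorem x_pow_mul_mem (h : IsOreHom j x σ δ) {n : ℕ} {y : B} (hy : y ∈ oreDegLT j x n) (i : ℕ) :
    x ^ i * y ∈ oreDegLT j x (n + i) := by
  induction i with
  | zero => simpa using hy
  | succ i ih =>
    rw [pow_succ', mul_assoc, ← add_assoc]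
    exact h.x_mul_mem ih

theorem mul_mem_left (h : IsOreHom j x σ δ) {n m : ℕ} {y z : B} (hy : y ∈ oreDegLT j x n)
    (hz : z ∈ oreDegLT j x (m + 1)) : y * z ∈ oreDegLT j x (n + m) := by
  have : oreDegLT j x n ≤ (oreDegLT j x (n + m)).comap (LinearMap.mulRight k z) := by
    refine oreDegLT_le fun i hi s => ?_
    simp only [Submodule.mem_comap, LinearMap.mulRight_apply]
    rw [mul_assoc]
    exact map_mul_mem_oreDegLT _ (oreDegLT_mono (by omega) (h.x_pow_mul_mem hz i))
  exact this hy

theorem pow_mul_map_lead (h : IsOreHom j x σ δ) (n : ℕ) (r : R) :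
    OreLead j x (x ^ n * j r) n ((σ ^ n) r) := by
  induction n with
  | zero => simp [OreLead]
  | succ n ih =>
    have h1 := h.x_mul_mem ih
    have h2 : j (δ ((σ ^ n) r)) * x ^ n ∈ oreDegLT j x (n + 1) :=
      mul_pow_mem_oreDegLT _ (Nat.lt_succ_self n)
    have h3 : x * (j ((σ ^ n) r) * x ^ n) =
        j ((σ ^ (n + 1)) r) * x ^ (n + 1) + j (δ ((σ ^ n) r)) * x ^ n := by
      rw [← mul_assoc, h.comm, add_mul, mul_assoc, ← pow_succ', pow_succ' σ, AlgEquiv.mul_apply]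
    have h4 := add_mem h1 h2
    rw [mul_sub, h3, sub_add_eq_sub_sub, sub_add_cancel, ← mul_assoc, ← pow_succ'] at h4
    exact h4

theorem lead_mul (h : IsOreHom j x σ δ) {n m : ℕ} {y z : B} {c e : R} (hy : OreLead j x y n c)
    (hz : OreLead j x z m e) : OreLead j x (y * z) (n + m) (c * (σ ^ n) e) := by
  -- The error telescopes into three terms: `y` is replaced by its leading term, then `z`, and
  -- finally `x ^ n` is moved past `e`.
  have h1 := h.mul_mem_left hy (mem_oreDegLT_succ_iff.2 ⟨e, hz⟩)
  have h2 : j c * (x ^ n * (z - j e * x ^ m)) ∈ oreDegLT j x (n + m) :=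
    map_mul_mem_oreDegLT c (by simpa [add_comm] using h.x_pow_mul_mem hz n)
  have h3 : j c * ((x ^ n * j e - j ((σ ^ n) e) * x ^ n) * x ^ m) ∈ oreDegLT j x (n + m) :=
    map_mul_mem_oreDegLT c (mul_pow_right_mem_oreDegLT (h.pow_mul_map_lead n e))
  have h4 := add_mem (add_mem h1 h2) h3
  unfold OreLead
  convert h4 using 1
  rw [pow_add, map_mul]
  noncomm_ring

theorem lead_pow [NoZeroDivisors R] [Nontrivial R] (h : IsOreHom j x σ δ) {n : ℕ} {y : B} {c : R}
    (hy : OreLead j x y n c) (hc : c ≠ 0) (i : ℕ) :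
    ∃ e, e ≠ 0 ∧ OreLead j x (y ^ i) (i * n) e := by
  induction i with
  | zero => exact ⟨1, one_ne_zero, by simp [OreLead]⟩
  | succ i ih =>
    obtain ⟨e, he, hl⟩ := ih
    refine ⟨e * (σ ^ (i * n)) c,
      mul_ne_zero he ((map_ne_zero_iff _ (σ ^ (i * n)).injective).2 hc), ?_⟩
    rw [pow_succ, Nat.succ_mul]
    exact h.lead_mul hl hy

theorem noZeroDivisors [NoZeroDivisors R] (h : IsOreHom j x σ δ) : NoZeroDivisors B where
  eq_zero_or_eq_zero_of_mul_eq_zero {y z} hyz := by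
    by_contra! hne
    obtain ⟨n, c, hc, hy⟩ := h.exists_lead hne.1
    obtain ⟨m, e, he, hz⟩ := h.exists_lead hne.2
    have h1 := h.lead_mul hy hz
    have h2 : c * (σ ^ n) e ≠ 0 := mul_ne_zero hc ((map_ne_zero_iff _ (σ ^ n).injective).2 he)
    rw [OreLead, hyz, zero_sub, neg_mem_iff] at h1
    exact h2 (h.eq_zero_of_mul_pow_mem h1)

/-- Units of an Ore extension of a domain have degree zero. -/
theorem eq_zero_of_mul_eq_one [NoZeroDivisors R] [Nontrivial R] (h : IsOreHom j x σ δ) {a b : R}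
    {z : B} (hz : z * (j a + j b * x) = 1) : b = 0 := by
  by_contra hb
  have : Nontrivial B := h.injective.nontrivial
  have hz0 : z ≠ 0 := by rintro rfl; simp at hz
  obtain ⟨n, c, hc, hlz⟩ := h.exists_lead hz0
  have hl : OreLead j x (j a + j b * x) 1 b := by
    simpa [OreLead] using map_mem_oreDegLT a one_pos
  have h1 := h.lead_mul hlz hl
  rw [hz] at h1
  have h2 : OreLead j x (1 : B) 0 1 := by simp [OreLead]
  have := h.lead_unique h1 h2
    (mul_ne_zero hc ((map_ne_zero_iff _ (σ ^ n).injective).2 hb)) one_ne_zero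
  omega

variable (T)

/-- Tensoring with `T` commutes with the direct sum over powers of `x`, so freeness is inherited.
This makes `B ⊗ B` and `B ⊗ (B ⊗ B)` Ore extensions in each tensor factor separately, which gives
degrees in each factor. -/
theorem lTensor (h : IsOreHom j x σ δ) :
    IsOreHom (Algebra.TensorProduct.map (AlgHom.id k T) j) (1 ⊗ₜ[k] x)
      (Algebra.TensorProduct.congr AlgEquiv.refl σ) (LinearMap.lTensor T δ) where
  comm r := by
    induction r with
    | zero => simp
    | tmul t r => simp [h.comm, TensorProduct.tmul_add]
    | add a b ha hb =>
      simp only [map_add, mul_add, add_mul, ha, hb]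
      abel
  bij := by
    have key : (oreSum (Algebra.TensorProduct.map (AlgHom.id k T) j) (1 ⊗ₜ[k] x)) ∘ₗ
        (TensorProduct.finsuppRight k k T R ℕ).toLinearMap =
        LinearMap.lTensor T (oreSum j x) := by
      ext t i r
      simp [oreSum_single]
    have h2 : Function.Bijective (LinearMap.lTensor T (oreSum j x)) :=
      (LinearEquiv.lTensor T (LinearEquiv.ofBijective _ h.bij)).bijective
    rw [← key, LinearMap.coe_comp] at h2
    exact (Function.Bijective.of_comp_iff _
      (TensorProduct.finsuppRight k k T R ℕ).bijective).1 h2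

theorem rTensor (h : IsOreHom j x σ δ) :
    IsOreHom (Algebra.TensorProduct.map j (AlgHom.id k T)) (x ⊗ₜ[k] 1)
      (Algebra.TensorProduct.congr σ AlgEquiv.refl) (LinearMap.rTensor T δ) where
  comm r := by
    induction r with
    | zero => simp
    | tmul t r => simp [h.comm, TensorProduct.add_tmul]
    | add a b ha hb =>
      simp only [map_add, mul_add, add_mul, ha, hb]
      abel
  bij := by
    have key : (oreSum (Algebra.TensorProduct.map j (AlgHom.id k T)) (x ⊗ₜ[k] 1)) ∘ₗ
        (TensorProduct.finsuppLeft k k R T ℕ).toLinearMap =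
        LinearMap.rTensor T (oreSum j x) := by
      ext i r t
      simp [oreSum_single, TensorProduct.finsuppLeft_apply_tmul]
    have h2 : Function.Bijective (LinearMap.rTensor T (oreSum j x)) :=
      (LinearEquiv.rTensor T (LinearEquiv.ofBijective _ h.bij)).bijective
    rw [← key, LinearMap.coe_comp] at h2
    exact (Function.Bijective.of_comp_iff _
      (TensorProduct.finsuppLeft k k R T ℕ).bijective).1 h2

end IsOreHom

end OreHom

/-- If `u` in the Ore extension `A` of `A₀` with variable `y` has the same image under two
homomorphisms `f`, `g` to an Ore extension `C` of a domain `C₀` with variable `z`, where `g`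
preserves degrees and `f` multiplies degrees by that of `u`, then `u` has degree at most `1`. -/
theorem mem_oreDegLT_two_of_map_eq {k : Type*} [Field k] {A₀ A C₀ C : Type*} [Ring A₀]
    [Algebra k A₀] [Ring A] [Algebra k A] [Ring C₀] [Algebra k C₀] [Ring C] [Algebra k C]
    [NoZeroDivisors C₀] [Nontrivial C₀]
    {i : A₀ →ₐ[k] A} {y : A} {σ : A₀ ≃ₐ[k] A₀} {δ : A₀ →ₗ[k] A₀} (hA : IsOreHom i y σ δ)
    {l : C₀ →ₐ[k] C} {z : C} {σ' : C₀ ≃ₐ[k] C₀} {δ' : C₀ →ₗ[k] C₀} (hC : IsOreHom l z σ' δ')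
    (f g κ : A →ₐ[k] C) (f₀ g₀ κ₀ : A₀ →ₐ[k] C₀) (hf₀ : Function.Injective f₀)
    (hg₀ : Function.Injective g₀) (hκ₀ : Function.Injective κ₀)
    (hf : ∀ a, f (i a) = l (f₀ a)) (hg : ∀ a, g (i a) = l (g₀ a))
    (hκ : ∀ a, κ (i a) = l (κ₀ a)) (u : A) (hgy : g y = z) (hκy : κ y = z) (hfy : f y = κ u)
    (hu : f u = g u) : u ∈ oreDegLT i y 2 := by
  by_cases hu0 : u = 0
  · simp [hu0]
  -- In the application `u = Δ(x)`, `y = x ⊗ 1`, `f = Δ ⊗ id`, `g = id ⊗ Δ` and `κ(u) = u ⊗ 1`, or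
  -- the mirror image.
  obtain ⟨n, c, hc, hl⟩ := hA.exists_lead hu0
  have lead_map : ∀ (g : A →ₐ[k] C) (g₀ : A₀ →ₐ[k] C₀), (∀ a, g (i a) = l (g₀ a)) → g y = z →
      OreLead l z (g u) n (g₀ c) := by
    intro g g₀ hg hgy
    have : oreDegLT i y n ≤ (oreDegLT l z n).comap g.toLinearMap := by
      refine oreDegLT_le fun m hm r => ?_
      simpa [hg, hgy] using mul_pow_mem_oreDegLT (g₀ r) hm
    simpa [OreLead, hg, hgy] using this hl
  have h1 := lead_map g g₀ hg hgy
  have h2 := lead_map κ κ₀ hκ hκy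
  have hκc : κ₀ c ≠ 0 := (map_ne_zero_iff κ₀ hκ₀).2 hc
  rcases Nat.eq_zero_or_pos n with rfl | hn
  · exact oreDegLT_mono one_le_two (mem_oreDegLT_succ_iff.2 ⟨c, hl⟩)
  -- Since `f y = κ u` has degree `n`, a term of degree `m < n` is sent to degree at most `m * n`,
  -- which is less than `n * n` because `n` is positive.
  have hlow : oreDegLT i y n ≤ (oreDegLT l z (n * n)).comap f.toLinearMap := by
    refine oreDegLT_le fun m hm r => ?_
    obtain ⟨e, -, he⟩ := hC.lead_pow h2 hκc m
    have : m * n + 1 ≤ n * n := by nlinarith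
    simpa [hf, hfy] using map_mul_mem_oreDegLT (f₀ r)
      (oreDegLT_mono this (mem_oreDegLT_succ_iff.2 ⟨e, he⟩))
  obtain ⟨e, he0, he⟩ := hC.lead_pow h2 hκc n
  have h3 : OreLead l z (f u) (n * n) (f₀ c * e) := by
    have h4 : f _ ∈ oreDegLT l z (n * n) := hlow hl
    have h5 := map_mul_mem_oreDegLT (f₀ c) he
    have h6 := add_mem h4 h5
    simp only [map_sub, map_mul, map_pow, hf, hfy] at h6
    rw [mul_sub, sub_add_sub_cancel] at h6
    rw [OreLead, map_mul, mul_assoc]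
    exact h6
  -- The common value `f u = g u` has degree `n * n` and degree `n`.
  have h7 := hC.lead_unique h3 (hu ▸ h1) (mul_ne_zero ((map_ne_zero_iff f₀ hf₀).2 hc) he0)
    ((map_ne_zero_iff g₀ hg₀).2 hc)
  have hn1 : n = 1 := by nlinarith
  subst hn1
  exact mem_oreDegLT_succ_iff.2 ⟨c, hl⟩

/-! ### Algebras with a basis that is multiplicative up to terms of lower weight -/

section Symbol

variable {k : Type*} [Field k] {ι ι' ι'' : Type*} {A A' A'' : Type*} [Ring A] [Algebra k A]
  [Ring A'] [Algebra k A'] [Ring A''] [Algebra k A'']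

/-- The span of the basis elements of weight less than `r`. -/
def pbwLT (b : Module.Basis (ι →₀ ℕ) k A) (d : ι → ℕ) (r : ℕ) : Submodule k A :=
  Submodule.span k (b '' {m | Finsupp.weight d m < r})

/-- The linear map that sends the basis element with exponent `m` to the monomial `X ^ m`, followed
by the projection to the weighted homogeneous component of weight `r`. -/
noncomputable def pbwSymbol (b : Module.Basis (ι →₀ ℕ) k A) (d : ι → ℕ) (r : ℕ) :
    A →ₗ[k] MvPolynomial ι k :=
  MvPolynomial.weightedHomogeneousComponent d r ∘ₗ
    (b.equiv (MvPolynomial.basisMonomials ι k) (Equiv.refl _)).toLinearMap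

/-- The basis `b` is multiplicative up to terms of lower weight. -/
structure IsPBWDeformation (b : Module.Basis (ι →₀ ℕ) k A) (d : ι → ℕ) : Prop where
  one : b 0 = 1
  mul : ∀ m m', b m * b m' - b (m + m') ∈ pbwLT b d (Finsupp.weight d m + Finsupp.weight d m')

variable {b : Module.Basis (ι →₀ ℕ) k A} {d : ι → ℕ} {b' : Module.Basis (ι' →₀ ℕ) k A'}
  {d' : ι' → ℕ} {b'' : Module.Basis (ι'' →₀ ℕ) k A''} {d'' : ι'' → ℕ}

theorem mem_pbwLT {r : ℕ} {a : A} :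
    a ∈ pbwLT b d r ↔ ∀ m ∈ (b.repr a).support, Finsupp.weight d m < r := by
  rw [pbwLT, Module.Basis.mem_span_image]
  rfl

theorem basis_mem_pbwLT {r : ℕ} {m : ι →₀ ℕ} (h : Finsupp.weight d m < r) :
    b m ∈ pbwLT b d r :=
  Submodule.subset_span ⟨m, h, rfl⟩

theorem pbwLT_le {r : ℕ} {S : Submodule k A} (h : ∀ m, Finsupp.weight d m < r → b m ∈ S) :
    pbwLT b d r ≤ S := by
  refine Submodule.span_le.2 ?_
  rintro _ ⟨m, hm, rfl⟩
  exact h m hm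

theorem pbwLT_mono {r s : ℕ} (h : r ≤ s) : pbwLT b d r ≤ pbwLT b d s :=
  pbwLT_le fun _ hm => basis_mem_pbwLT (hm.trans_le h)

/-- With a strict bound, `pbwLT b d r` plays the role of `C_{r-1}` and `pbwLT b d (r + 1)` that of
`C_r`, including `C_{-1} = 0`. -/
theorem pbwLT_zero : pbwLT b d 0 = ⊥ := by
  rw [eq_bot_iff]
  exact pbwLT_le fun m hm => absurd hm (Nat.not_lt_zero _)

theorem exists_mem_pbwLT (b : Module.Basis (ι →₀ ℕ) k A) (d : ι → ℕ) (a : A) :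
    ∃ r, a ∈ pbwLT b d (r + 1) :=
  ⟨(b.repr a).support.sup fun m => Finsupp.weight d m, mem_pbwLT.2 fun _ hm =>
    Nat.lt_succ_of_le (Finset.le_sup (f := fun m => Finsupp.weight d m) hm)⟩

theorem pbwSymbol_basis (r : ℕ) (m : ι →₀ ℕ) : pbwSymbol b d r (b m) =
    if Finsupp.weight d m = r then MvPolynomial.monomial m 1 else 0 := by
  have h := MvPolynomial.isWeightedHomogeneous_monomial d m (1 : k) rfl
  simp only [pbwSymbol, LinearMap.comp_apply, LinearEquiv.coe_coe, Module.Basis.equiv_apply,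
    Equiv.refl_apply, MvPolynomial.coe_basisMonomials]
  split_ifs with hr
  · subst hr
    exact h.weightedHomogeneousComponent_same
  · exact h.weightedHomogeneousComponent_ne r (Ne.symm hr)

theorem pbwSymbol_isWeightedHomogeneous (r : ℕ) (a : A) :
    (pbwSymbol b d r a).IsWeightedHomogeneous d r :=
  MvPolynomial.weightedHomogeneousComponent_isWeightedHomogeneous r _

theorem pbwSymbol_eq_zero {r s : ℕ} (h : r ≤ s) {a : A} (ha : a ∈ pbwLT b d r) :
    pbwSymbol b d s a = 0 := by
  have : pbwLT b d r ≤ LinearMap.ker (pbwSymbol b d s) := by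
    refine pbwLT_le fun m hm => ?_
    rw [LinearMap.mem_ker, pbwSymbol_basis, if_neg (by omega)]
  exact this ha

theorem coeff_pbwSymbol (r : ℕ) (a : A) (m : ι →₀ ℕ) :
    (pbwSymbol b d r a).coeff m = if Finsupp.weight d m = r then b.repr a m else 0 := by
  classical
  have : MvPolynomial.lcoeff k m ∘ₗ pbwSymbol b d r =
      if Finsupp.weight d m = r then b.coord m else 0 := by
    refine b.ext fun n => ?_
    rw [LinearMap.comp_apply, pbwSymbol_basis, MvPolynomial.lcoeff_apply]
    by_cases hmn : n = m
    · subst hmn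
      split_ifs <;> simp
    · split_ifs <;> simp [hmn]
  have h := LinearMap.congr_fun this a
  rw [LinearMap.comp_apply, MvPolynomial.lcoeff_apply] at h
  rw [h]
  split_ifs <;> simp

/-- Together with `pbwSymbol_eq_zero` this says that the kernel of the symbol on `C_r` is `C_{r-1}`.
-/
theorem mem_pbwLT_of_pbwSymbol_eq_zero {r : ℕ} {a : A} (ha : a ∈ pbwLT b d (r + 1))
    (h : pbwSymbol b d r a = 0) : a ∈ pbwLT b d r := by
  rw [mem_pbwLT] at ha ⊢
  intro m hm
  refine lt_of_le_of_ne (Nat.lt_succ_iff.1 (ha m hm)) fun he => ?_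
  have := coeff_pbwSymbol (b := b) (d := d) r a m
  rw [h, if_pos he, MvPolynomial.coeff_zero] at this
  exact Finsupp.mem_support_iff.1 hm this.symm

theorem exists_pbwSymbol_ne_zero (b : Module.Basis (ι →₀ ℕ) k A) (d : ι → ℕ) {a : A}
    (ha : a ≠ 0) : ∃ r, a ∈ pbwLT b d (r + 1) ∧ pbwSymbol b d r a ≠ 0 := by
  classical
  have hspec := Nat.find_spec (exists_mem_pbwLT b d a)
  refine ⟨_, hspec, fun h0 => ?_⟩
  have h1 := mem_pbwLT_of_pbwSymbol_eq_zero hspec h0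
  rcases hr : Nat.find (exists_mem_pbwLT b d a) with _ | r
  · rw [hr, pbwLT_zero] at h1
    exact ha h1
  · rw [hr] at h1
    exact Nat.find_min (exists_mem_pbwLT b d a) (by omega) h1

namespace IsPBWDeformation

theorem basis_mul_mem (h : IsPBWDeformation b d) {m m' : ι →₀ ℕ} {r : ℕ}
    (hr : Finsupp.weight d m + Finsupp.weight d m' < r) : b m * b m' ∈ pbwLT b d r := by
  have := add_mem (pbwLT_mono hr.le (h.mul m m'))
    (basis_mem_pbwLT (b := b) (d := d) (m := m + m') (by rwa [map_add]))
  simpa using this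

theorem mul_mem_left (h : IsPBWDeformation b d) {r s : ℕ} {a c : A} (ha : a ∈ pbwLT b d r)
    (hc : c ∈ pbwLT b d (s + 1)) : a * c ∈ pbwLT b d (r + s) := by
  have h1 : ∀ m, Finsupp.weight d m < r →
      pbwLT b d (s + 1) ≤ (pbwLT b d (r + s)).comap (LinearMap.mulLeft k (b m)) := by
    intro m hm
    exact pbwLT_le fun m' hm' => h.basis_mul_mem (by omega)
  have h2 : pbwLT b d r ≤ (pbwLT b d (r + s)).comap (LinearMap.mulRight k c) :=
    pbwLT_le fun m hm => h1 m hm hc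
  exact h2 ha

theorem mul_mem (h : IsPBWDeformation b d) {r s : ℕ} {a c : A} (ha : a ∈ pbwLT b d (r + 1))
    (hc : c ∈ pbwLT b d (s + 1)) : a * c ∈ pbwLT b d (r + s + 1) := by
  have := h.mul_mem_left ha hc
  rwa [add_right_comm] at this

theorem mul_mem_right (h : IsPBWDeformation b d) {r s : ℕ} {a c : A} (ha : a ∈ pbwLT b d (r + 1))
    (hc : c ∈ pbwLT b d s) : a * c ∈ pbwLT b d (r + s) := by
  rcases s with _ | s
  · rw [pbwLT_zero, Submodule.mem_bot] at hc
    simp [hc]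
  · exact h.mul_mem ha hc

theorem one_mem (h : IsPBWDeformation b d) : (1 : A) ∈ pbwLT b d 1 := by
  rw [← h.one]
  exact basis_mem_pbwLT (by simp)

/-- On basis elements this is the relation `b m * b m' ≡ b (m + m')`, whose right side is symmetric
in `m` and `m'`: commutativity of the associated graded algebra comes from here. The rest is
bilinearity. -/
theorem symbol_mul (h : IsPBWDeformation b d) {r s : ℕ} {a c : A} (ha : a ∈ pbwLT b d (r + 1))
    (hc : c ∈ pbwLT b d (s + 1)) :
    pbwSymbol b d (r + s) (a * c) = pbwSymbol b d r a * pbwSymbol b d s c := by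
  have h0 : ∀ m, Finsupp.weight d m < r + 1 → ∀ m', Finsupp.weight d m' < s + 1 →
      pbwSymbol b d (r + s) (b m * b m') =
        pbwSymbol b d r (b m) * pbwSymbol b d s (b m') := by
    intro m hm m' hm'
    have h1 := pbwSymbol_eq_zero (s := r + s) (by omega) (h.mul m m')
    rw [map_sub, sub_eq_zero] at h1
    rw [h1, pbwSymbol_basis, pbwSymbol_basis, pbwSymbol_basis, map_add]
    by_cases e1 : Finsupp.weight d m = r
    · by_cases e2 : Finsupp.weight d m' = s
      · simp [e1, e2, MvPolynomial.monomial_mul]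
      · rw [if_neg (by omega), if_neg e2, mul_zero]
    · rw [if_neg (by omega), if_neg e1, zero_mul]
  have h1 : ∀ m, Finsupp.weight d m < r + 1 → pbwLT b d (s + 1) ≤ LinearMap.eqLocus
      (pbwSymbol b d (r + s) ∘ₗ LinearMap.mulLeft k (b m))
      (LinearMap.mulLeft k (pbwSymbol b d r (b m)) ∘ₗ pbwSymbol b d s) :=
    fun m hm => pbwLT_le fun m' hm' => h0 m hm m' hm'
  have h2 : pbwLT b d (r + 1) ≤ LinearMap.eqLocus
      (pbwSymbol b d (r + s) ∘ₗ LinearMap.mulRight k c)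
      (LinearMap.mulRight k (pbwSymbol b d s c) ∘ₗ pbwSymbol b d r) :=
    pbwLT_le fun m hm => h1 m hm hc
  exact h2 ha

/-- Top symbols multiply in a polynomial ring over a field, which is a domain. -/
theorem noZeroDivisors (h : IsPBWDeformation b d) : NoZeroDivisors A where
  eq_zero_or_eq_zero_of_mul_eq_zero {y z} hyz := by
    by_contra! hne
    obtain ⟨r, hr, hr0⟩ := exists_pbwSymbol_ne_zero b d hne.1
    obtain ⟨s, hs, hs0⟩ := exists_pbwSymbol_ne_zero b d hne.2
    have := h.symbol_mul hr hs
    rw [hyz, map_zero] at this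
    exact mul_ne_zero hr0 hs0 this.symm

/-- An increasing multiplicative family of subspaces contains the filtration by weight if it
contains the generators. -/
theorem pbwLT_le_of_generators (h : IsPBWDeformation b d) (hd : ∀ i, 0 < d i)
    (S : ℕ → Submodule k A) (mono : Monotone S) (one : (1 : A) ∈ S 0)
    (gen : ∀ i, b (Finsupp.single i 1) ∈ S (d i))
    (mul : ∀ r s a c, a ∈ S r → c ∈ S s → a * c ∈ S (r + s)) (r : ℕ) :
    pbwLT b d (r + 1) ≤ S r := by
  have key : ∀ w m, Finsupp.weight d m = w → b m ∈ S w := by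
    intro w
    induction w using Nat.strong_induction_on with
    | _ w ih =>
      intro m hm
      by_cases h0 : m = 0
      · subst h0
        rw [h.one]
        exact mono (Nat.zero_le _) one
      -- Any variable occurring in `m` may be split off on the left, whatever its position, since
      -- reordering costs only terms of lower weight. Positivity of `d i` makes the remaining factor
      -- lighter.
      obtain ⟨i, hi⟩ := Finsupp.ne_iff.1 h0
      obtain ⟨m', rfl⟩ : ∃ m', m = Finsupp.single i 1 + m' :=
        exists_add_of_le (Finsupp.single_le_iff.2 (Nat.one_le_iff_ne_zero.2 hi))
      have hw : d i + Finsupp.weight d m' = w := by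
        rw [← hm, map_add]
        simp [Finsupp.weight_apply]
      have h1 : pbwLT b d w ≤ S w := pbwLT_le fun n hn => mono hn.le (ih _ hn n rfl)
      have h2 := mul _ _ _ _ (gen i) (ih _ (by have := hd i; omega) m' rfl)
      have h3 := h.mul (Finsupp.single i 1) m'
      rw [← map_add, hm] at h3
      rw [hw] at h2
      have := sub_mem h2 (h1 h3)
      simpa using this
  exact pbwLT_le fun m hm => mono (Nat.lt_succ_iff.1 hm) (key _ m rfl)

end IsPBWDeformation

/-- The homomorphism `f` respects the filtrations by weight, and induces `φ` on symbols. -/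
structure IsSymbolHom (b : Module.Basis (ι →₀ ℕ) k A) (d : ι → ℕ)
    (b' : Module.Basis (ι' →₀ ℕ) k A') (d' : ι' → ℕ) (f : A →ₐ[k] A')
    (φ : MvPolynomial ι k →ₐ[k] MvPolynomial ι' k) : Prop where
  mem : ∀ r a, a ∈ pbwLT b d (r + 1) → f a ∈ pbwLT b' d' (r + 1)
  symbol : ∀ r a, a ∈ pbwLT b d (r + 1) → pbwSymbol b' d' r (f a) = φ (pbwSymbol b d r a)

theorem pbwSymbol_zero_one (h : IsPBWDeformation b d) : pbwSymbol b d 0 1 = 1 := by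
  rw [← h.one, pbwSymbol_basis, if_pos (by simp)]
  rfl

theorem pbwSymbol_generator (i : ι) :
    pbwSymbol b d (d i) (b (Finsupp.single i 1)) = MvPolynomial.X i := by
  rw [pbwSymbol_basis, if_pos (by simp [Finsupp.weight_apply])]
  rfl

theorem generator_mem_pbwLT (i : ι) : b (Finsupp.single i 1) ∈ pbwLT b d (d i + 1) :=
  basis_mem_pbwLT (by simp [Finsupp.weight_apply])

namespace IsSymbolHom

theorem of_generators (h : IsPBWDeformation b d) (hd : ∀ i, 0 < d i)
    (h' : IsPBWDeformation b' d') (f : A →ₐ[k] A')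
    (φ : MvPolynomial ι k →ₐ[k] MvPolynomial ι' k)
    (mem : ∀ i, f (b (Finsupp.single i 1)) ∈ pbwLT b' d' (d i + 1))
    (symbol : ∀ i, pbwSymbol b' d' (d i) (f (b (Finsupp.single i 1))) = φ (MvPolynomial.X i)) :
    IsSymbolHom b d b' d' f φ := by
  -- The bound on `a` itself is part of `S r` because multiplicativity of symbols requires it.
  let S : ℕ → Submodule k A := fun r => pbwLT b d (r + 1) ⊓
    ((pbwLT b' d' (r + 1)).comap f.toLinearMap ⊓
      LinearMap.eqLocus (pbwSymbol b' d' r ∘ₗ f.toLinearMap) (φ.toLinearMap ∘ₗ pbwSymbol b d r))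
  have hS : ∀ r a, a ∈ S r ↔ a ∈ pbwLT b d (r + 1) ∧ f a ∈ pbwLT b' d' (r + 1) ∧
      pbwSymbol b' d' r (f a) = φ (pbwSymbol b d r a) := fun r a => Iff.rfl
  have key := h.pbwLT_le_of_generators hd S ?_ ?_ ?_ ?_
  · exact ⟨fun r a ha => ((hS r a).1 (key r ha)).2.1, fun r a ha => ((hS r a).1 (key r ha)).2.2⟩
  · intro r s hrs a ha
    rcases hrs.eq_or_lt with rfl | hlt
    · exact ha
    rw [hS] at ha ⊢
    refine ⟨pbwLT_mono (by omega) ha.1, pbwLT_mono (by omega) ha.2.1, ?_⟩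
    -- Symbols of weight `s > r` vanish on both sides.
    rw [pbwSymbol_eq_zero hlt ha.1, pbwSymbol_eq_zero hlt ha.2.1, map_zero]
  · rw [hS, map_one, pbwSymbol_zero_one h, pbwSymbol_zero_one h', map_one]
    exact ⟨h.one_mem, h'.one_mem, rfl⟩
  · intro i
    rw [hS, pbwSymbol_generator, symbol]
    exact ⟨generator_mem_pbwLT i, mem i, rfl⟩
  · intro r s a c ha hc
    rw [hS] at ha hc ⊢
    rw [map_mul, h.symbol_mul ha.1 hc.1, h'.symbol_mul ha.2.1 hc.2.1, ha.2.2, hc.2.2, map_mul]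
    exact ⟨h.mul_mem ha.1 hc.1, h'.mul_mem ha.2.1 hc.2.1, rfl⟩

theorem comp {g : A' →ₐ[k] A''} {ψ : MvPolynomial ι' k →ₐ[k] MvPolynomial ι'' k}
    {f : A →ₐ[k] A'} {φ : MvPolynomial ι k →ₐ[k] MvPolynomial ι' k}
    (hg : IsSymbolHom b' d' b'' d'' g ψ) (hf : IsSymbolHom b d b' d' f φ) :
    IsSymbolHom b d b'' d'' (g.comp f) (ψ.comp φ) where
  mem r a ha := hg.mem _ _ (hf.mem _ _ ha)
  symbol r a ha := by
    rw [AlgHom.comp_apply, hg.symbol _ _ (hf.mem _ _ ha), hf.symbol _ _ ha, AlgHom.comp_apply]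

end IsSymbolHom

/-! ### Tensor products -/

/-- The basis of a tensor product that consists of the products of basis elements. -/
noncomputable def pbwTensor (b : Module.Basis (ι →₀ ℕ) k A) (b' : Module.Basis (ι' →₀ ℕ) k A') :
    Module.Basis (ι ⊕ ι' →₀ ℕ) k (A ⊗[k] A') :=
  (b.tensorProduct b').reindex Finsupp.sumFinsuppEquivProdFinsupp.symm

theorem pbwTensor_sumElim (m : ι →₀ ℕ) (m' : ι' →₀ ℕ) :
    pbwTensor b b' (Finsupp.sumElim m m') = b m ⊗ₜ[k] b' m' := by
  have : Finsupp.sumElim m m' = Finsupp.sumFinsuppEquivProdFinsupp.symm (m, m') := rfl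
  rw [pbwTensor, this, Module.Basis.reindex_apply, Equiv.symm_symm, Equiv.apply_symm_apply,
    Module.Basis.tensorProduct_apply]

theorem exists_eq_sumElim (m : ι ⊕ ι' →₀ ℕ) : ∃ p q, m = Finsupp.sumElim p q :=
  ⟨_, _, (Finsupp.sumFinsuppEquivProdFinsupp.symm_apply_apply m).symm⟩

theorem weight_sumElim (m : ι →₀ ℕ) (m' : ι' →₀ ℕ) :
    Finsupp.weight (Sum.elim d d') (Finsupp.sumElim m m') =
      Finsupp.weight d m + Finsupp.weight d' m' := by
  have hl : ∀ m : ι →₀ ℕ, Finsupp.weight (Sum.elim d d') (Finsupp.sumElim m (0 : ι' →₀ ℕ)) =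
      Finsupp.weight d m := by
    intro m
    induction m using Finsupp.induction_linear with
    | zero => simp
    | add p q hp hq => rw [← add_zero (0 : ι' →₀ ℕ), Finsupp.sumElim_add, map_add, hp, hq, map_add]
    | single i c => simp [Finsupp.weight_single]
  have hr : ∀ m : ι' →₀ ℕ, Finsupp.weight (Sum.elim d d') (Finsupp.sumElim (0 : ι →₀ ℕ) m) =
      Finsupp.weight d' m := by
    intro m
    induction m using Finsupp.induction_linear with
    | zero => simp
    | add p q hp hq => rw [← add_zero (0 : ι →₀ ℕ), Finsupp.sumElim_add, map_add, hp, hq, map_add]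
    | single i c => simp [Finsupp.weight_single]
  rw [← hl, ← hr, ← map_add, ← Finsupp.sumElim_add, add_zero, zero_add]

/-- Both bounds are strict, so the weights add up to at most `r + s - 2`; hence the `t + 1`. -/
theorem tmul_mem_pbwLT {r s t : ℕ} {a : A} {c : A'} (ha : a ∈ pbwLT b d r)
    (hc : c ∈ pbwLT b' d' s) (ht : r + s ≤ t + 1) :
    a ⊗ₜ[k] c ∈ pbwLT (pbwTensor b b') (Sum.elim d d') t := by
  have h1 : ∀ m, Finsupp.weight d m < r → pbwLT b' d' s ≤
      (pbwLT (pbwTensor b b') (Sum.elim d d') t).comap (TensorProduct.mk k A A' (b m)) := by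
    intro m hm
    refine pbwLT_le fun m' hm' => ?_
    rw [Submodule.mem_comap, TensorProduct.mk_apply, ← pbwTensor_sumElim]
    exact basis_mem_pbwLT (by rw [weight_sumElim]; omega)
  have h2 : pbwLT b d r ≤ (pbwLT (pbwTensor b b') (Sum.elim d d') t).comap
      ((TensorProduct.mk k A A').flip c) := pbwLT_le fun m hm => h1 m hm hc
  exact h2 ha

/-- Symbols in `R ⊗ R` and `R ⊗ (R ⊗ R)` become polynomials in two and three groups of variables,
and these tensor powers are domains. -/
theorem IsPBWDeformation.tensor (h : IsPBWDeformation b d) (h' : IsPBWDeformation b' d') :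
    IsPBWDeformation (pbwTensor b b') (Sum.elim d d') where
  one := by
    have : (0 : ι ⊕ ι' →₀ ℕ) = Finsupp.sumElim 0 0 := by ext (i | i) <;> simp
    rw [this, pbwTensor_sumElim, h.one, h'.one]
    rfl
  mul m n := by
    obtain ⟨m, m', rfl⟩ := exists_eq_sumElim m
    obtain ⟨n, n', rfl⟩ := exists_eq_sumElim n
    rw [← Finsupp.sumElim_add]
    simp only [pbwTensor_sumElim, weight_sumElim, Algebra.TensorProduct.tmul_mul_tmul]
    have e : (b m * b n) ⊗ₜ[k] (b' m' * b' n') - b (m + n) ⊗ₜ[k] b' (m' + n') =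
        (b m * b n - b (m + n)) ⊗ₜ[k] (b' m' * b' n') +
          b (m + n) ⊗ₜ[k] (b' m' * b' n' - b' (m' + n')) := by
      rw [TensorProduct.sub_tmul, TensorProduct.tmul_sub]
      abel
    rw [e]
    refine add_mem (tmul_mem_pbwLT (h.mul m n) (h'.basis_mul_mem (Nat.lt_succ_self _)) ?_)
      (tmul_mem_pbwLT (basis_mem_pbwLT (d := d) (Nat.lt_succ_self _)) (h'.mul m' n') ?_)
    · omega
    · rw [map_add]
      omega

theorem pbwTensor_single_inl (h' : IsPBWDeformation b' d') (i : ι) :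
    pbwTensor b b' (Finsupp.single (Sum.inl i) 1) = b (Finsupp.single i 1) ⊗ₜ[k] 1 := by
  rw [← h'.one, ← pbwTensor_sumElim]
  congr 1
  classical
  ext (j | j) <;> simp [Finsupp.single_apply]

theorem pbwTensor_single_inr (h : IsPBWDeformation b d) (i : ι') :
    pbwTensor b b' (Finsupp.single (Sum.inr i) 1) = 1 ⊗ₜ[k] b' (Finsupp.single i 1) := by
  rw [← h.one, ← pbwTensor_sumElim]
  congr 1
  classical
  ext (j | j) <;> simp [Finsupp.single_apply]

end Symbol

/-! ### The comultiplication of the variable of a Hopf Ore extension -/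

section CubeMaps

variable (k : Type*) [Field k] (A : Type*) [Ring A] [Bialgebra k A]

/-- The homomorphism `Δ ⊗ id : A ⊗ A → A ⊗ A ⊗ A`. -/
noncomputable def comulLeft : A ⊗[k] A →ₐ[k] A ⊗[k] (A ⊗[k] A) :=
  (Algebra.TensorProduct.assoc k k k A A A).toAlgHom.comp
    (Algebra.TensorProduct.map (Bialgebra.comulAlgHom k A) (AlgHom.id k A))

/-- The homomorphism `id ⊗ Δ : A ⊗ A → A ⊗ A ⊗ A`. -/
noncomputable def comulRight : A ⊗[k] A →ₐ[k] A ⊗[k] (A ⊗[k] A) :=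
  Algebra.TensorProduct.map (AlgHom.id k A) (Bialgebra.comulAlgHom k A)

/-- The homomorphism `a ⊗ b ↦ a ⊗ b ⊗ 1`. -/
noncomputable def inclLeft : A ⊗[k] A →ₐ[k] A ⊗[k] (A ⊗[k] A) :=
  Algebra.TensorProduct.map (AlgHom.id k A) Algebra.TensorProduct.includeLeft

/-- The homomorphism `a ⊗ b ↦ 1 ⊗ a ⊗ b`. -/
noncomputable def inclRight : A ⊗[k] A →ₐ[k] A ⊗[k] (A ⊗[k] A) :=
  Algebra.TensorProduct.includeRight

variable {A}

theorem comulLeft_tmul_one (a : A) :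
    comulLeft k A (a ⊗ₜ[k] 1) = inclLeft k A (Coalgebra.comul (R := k) a) := by
  simp only [comulLeft, inclLeft, AlgHom.comp_apply, Algebra.TensorProduct.map_tmul,
    Bialgebra.comulAlgHom_apply]
  generalize Coalgebra.comul (R := k) a = w
  induction w with
  | zero => simp
  | tmul p q => simp
  | add p q hp hq => simp_all [TensorProduct.add_tmul]

theorem comulLeft_one_tmul (a : A) : comulLeft k A (1 ⊗ₜ[k] a) = 1 ⊗ₜ[k] (1 ⊗ₜ[k] a) := by
  simp [comulLeft, Algebra.TensorProduct.one_def]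

theorem comulRight_tmul_one (a : A) : comulRight k A (a ⊗ₜ[k] 1) = a ⊗ₜ[k] (1 ⊗ₜ[k] 1) := by
  simp [comulRight, Algebra.TensorProduct.one_def]

theorem comulRight_one_tmul (a : A) :
    comulRight k A (1 ⊗ₜ[k] a) = inclRight k A (Coalgebra.comul (R := k) a) := by
  simp [comulRight, inclRight]

theorem comulLeft_comul (a : A) : comulLeft k A (Coalgebra.comul (R := k) a) =
    comulRight k A (Coalgebra.comul (R := k) a) :=
  Coalgebra.coassoc_apply a

end CubeMaps

theorem algebraTensorMap_injective {k : Type*} [Field k] {A A' C C' : Type*} [Ring A]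
    [Algebra k A] [Ring A'] [Algebra k A'] [Ring C] [Algebra k C] [Ring C'] [Algebra k C']
    {f : A →ₐ[k] A'} {g : C →ₐ[k] C'} (hf : Function.Injective f) (hg : Function.Injective g) :
    Function.Injective (Algebra.TensorProduct.map f g) := by
  have h1 := Module.Flat.lTensor_preserves_injective_linearMap (M := A') g.toLinearMap hg
  have h2 := Module.Flat.rTensor_preserves_injective_linearMap (M := C) f.toLinearMap hf
  have h3 := h1.comp h2
  rw [← LinearMap.coe_comp, LinearMap.lTensor_comp_rTensor] at h3
  exact h3

theorem comulAlgHom_injective (k : Type*) [Field k] (A : Type*) [Ring A] [Bialgebra k A] :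
    Function.Injective (Bialgebra.comulAlgHom k A) := by
  intro a b hab
  have h := congrArg (LinearMap.rTensor A (Coalgebra.counit (R := k))) hab
  simp only [Bialgebra.comulAlgHom_apply, Coalgebra.rTensor_counit_comul] at h
  simpa using congrArg (TensorProduct.lid k A) h

theorem includeLeft_injective_field (k : Type*) [Field k] (A C : Type*) [Ring A] [Algebra k A]
    [Ring C] [Algebra k C] [Nontrivial C] :
    Function.Injective (Algebra.TensorProduct.includeLeft : A →ₐ[k] A ⊗[k] C) :=
  Algebra.TensorProduct.includeLeft_injective (FaithfulSMul.algebraMap_injective k C)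

theorem includeRight_injective_field (k : Type*) [Field k] (A C : Type*) [Ring A] [Algebra k A]
    [Ring C] [Algebra k C] [Nontrivial A] :
    Function.Injective (Algebra.TensorProduct.includeRight : C →ₐ[k] A ⊗[k] C) :=
  Algebra.TensorProduct.includeRight_injective (FaithfulSMul.algebraMap_injective k A)

section Cube

variable {k : Type*} [Field k] {R B : Type*} [Ring R] [Bialgebra k R] [Ring B] [Bialgebra k B]
  {j : R →ₐ[k] B} {x : B} {σ : R ≃ₐ[k] R} {δ : R →ₗ[k] R}

theorem comulLeft_map (hj : ∀ r, Coalgebra.comul (R := k) (j r) =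
      Algebra.TensorProduct.map j j (Coalgebra.comul (R := k) r)) (w : R ⊗[k] R) :
    comulLeft k B (Algebra.TensorProduct.map j j w) =
      Algebra.TensorProduct.map j (Algebra.TensorProduct.map j j) (comulLeft k R w) := by
  induction w with
  | zero => simp
  | add p q hp hq => simp_all
  | tmul p q =>
    simp only [comulLeft, AlgHom.comp_apply, Algebra.TensorProduct.map_tmul,
      Bialgebra.comulAlgHom_apply, hj, AlgHom.id_apply]
    generalize Coalgebra.comul (R := k) p = w
    induction w with
    | zero => simp
    | tmul p q => simp
    | add p q hp hq => simp_all [TensorProduct.add_tmul]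

theorem comulRight_map (hj : ∀ r, Coalgebra.comul (R := k) (j r) =
      Algebra.TensorProduct.map j j (Coalgebra.comul (R := k) r)) (w : R ⊗[k] R) :
    comulRight k B (Algebra.TensorProduct.map j j w) =
      Algebra.TensorProduct.map j (Algebra.TensorProduct.map j j) (comulRight k R w) := by
  induction w with
  | zero => simp
  | add p q hp hq => simp_all
  | tmul p q => simp [comulRight, hj]

theorem inclLeft_map (w : R ⊗[k] R) : inclLeft k B (Algebra.TensorProduct.map j j w) =
      Algebra.TensorProduct.map j (Algebra.TensorProduct.map j j) (inclLeft k R w) := by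
  induction w with
  | zero => simp
  | add p q hp hq => simp_all
  | tmul p q => simp [inclLeft]

theorem inclRight_map (w : R ⊗[k] R) : inclRight k B (Algebra.TensorProduct.map j j w) =
      Algebra.TensorProduct.map j (Algebra.TensorProduct.map j j) (inclRight k R w) := by
  simp [inclRight]

namespace IsOreHom

/-- Degrees are taken in the first tensor factor: `Δ ⊗ id` turns `x ⊗ 1` into `Δ(x) ⊗ 1`, while `id
⊗ Δ` fixes the degree, and coassociativity equates both images of `Δ(x)`. -/
theorem comul_mem_left (h : IsOreHom j x σ δ) (hj : ∀ r, Coalgebra.comul (R := k) (j r) =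
      Algebra.TensorProduct.map j j (Coalgebra.comul (R := k) r)) [Nontrivial R]
    [NoZeroDivisors (R ⊗[k] (R ⊗[k] R))] :
    Coalgebra.comul (R := k) x ∈
      oreDegLT (Algebra.TensorProduct.map j (AlgHom.id k B)) (x ⊗ₜ[k] (1 : B)) 2 := by
  have : Nontrivial B := h.injective.nontrivial
  -- The coefficient ring `R ⊗ (B ⊗ B)` is reached from the domain `R ⊗ (R ⊗ R)` by two Ore
  -- extensions.
  have : NoZeroDivisors (R ⊗[k] (R ⊗[k] B)) := ((h.lTensor R).lTensor R).noZeroDivisors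
  have : NoZeroDivisors (R ⊗[k] (B ⊗[k] B)) := ((h.rTensor B).lTensor R).noZeroDivisors
  refine mem_oreDegLT_two_of_map_eq (h.rTensor B) (h.rTensor (B ⊗[k] B)) (comulLeft k B)
    (comulRight k B) (inclLeft k B)
    ((Algebra.TensorProduct.assoc k k k R B B).toAlgHom.comp (Algebra.TensorProduct.map
      ((Algebra.TensorProduct.map (AlgHom.id k R) j).comp (Bialgebra.comulAlgHom k R))
      (AlgHom.id k B)))
    (Algebra.TensorProduct.map (AlgHom.id k R) (Bialgebra.comulAlgHom k B))
    (Algebra.TensorProduct.map (AlgHom.id k R) Algebra.TensorProduct.includeLeft)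
    ?_ ?_ ?_ ?_ ?_ ?_ _ ?_ ?_ ?_ (comulLeft_comul k x)
  · refine (Algebra.TensorProduct.assoc k k k R B B).injective.comp
      (algebraTensorMap_injective ?_ Function.injective_id)
    exact (algebraTensorMap_injective Function.injective_id h.injective).comp
      (comulAlgHom_injective k R)
  · exact algebraTensorMap_injective Function.injective_id (comulAlgHom_injective k B)
  · exact algebraTensorMap_injective Function.injective_id (includeLeft_injective_field k B B)
  · intro w
    induction w with
    | zero => simp
    | add p q hp hq => simp_all
    | tmul p q =>
      simp only [comulLeft, AlgHom.comp_apply, Algebra.TensorProduct.map_tmul,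
        Bialgebra.comulAlgHom_apply, hj, AlgHom.id_apply]
      generalize Coalgebra.comul (R := k) p = w
      induction w with
      | zero => simp
      | tmul p q => simp
      | add p q hp hq => simp_all [TensorProduct.add_tmul]
  · intro w
    induction w with
    | zero => simp
    | add p q hp hq => simp_all
    | tmul p q => simp [comulRight]
  · intro w
    induction w with
    | zero => simp
    | add p q hp hq => simp_all
    | tmul p q => simp [inclLeft]
  · rw [comulRight_tmul_one]
    rfl
  · simp [inclLeft, Algebra.TensorProduct.one_def]
  · rw [comulLeft_tmul_one]

theorem comul_mem_right (h : IsOreHom j x σ δ) (hj : ∀ r, Coalgebra.comul (R := k) (j r) =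
      Algebra.TensorProduct.map j j (Coalgebra.comul (R := k) r)) [Nontrivial R]
    [NoZeroDivisors (R ⊗[k] (R ⊗[k] R))] :
    Coalgebra.comul (R := k) x ∈
      oreDegLT (Algebra.TensorProduct.map (AlgHom.id k B) j) ((1 : B) ⊗ₜ[k] x) 2 := by
  have : Nontrivial B := h.injective.nontrivial
  have : NoZeroDivisors (R ⊗[k] (B ⊗[k] R)) := ((h.rTensor R).lTensor R).noZeroDivisors
  have : NoZeroDivisors (B ⊗[k] (B ⊗[k] R)) := (h.rTensor (B ⊗[k] R)).noZeroDivisors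
  refine mem_oreDegLT_two_of_map_eq (h.lTensor B) ((h.lTensor B).lTensor B) (comulRight k B)
    (comulLeft k B) (inclRight k B)
    (Algebra.TensorProduct.map (AlgHom.id k B)
      ((Algebra.TensorProduct.map j (AlgHom.id k R)).comp (Bialgebra.comulAlgHom k R)))
    ((Algebra.TensorProduct.assoc k k k B B R).toAlgHom.comp (Algebra.TensorProduct.map
      (Bialgebra.comulAlgHom k B) (AlgHom.id k R)))
    Algebra.TensorProduct.includeRight
    ?_ ?_ ?_ ?_ ?_ ?_ _ ?_ ?_ ?_ (comulLeft_comul k x).symm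
  · refine algebraTensorMap_injective Function.injective_id ?_
    exact (algebraTensorMap_injective h.injective Function.injective_id).comp
      (comulAlgHom_injective k R)
  · exact (Algebra.TensorProduct.assoc k k k B B R).injective.comp
      (algebraTensorMap_injective (comulAlgHom_injective k B) Function.injective_id)
  · exact includeRight_injective_field k B (B ⊗[k] R)
  · intro w
    induction w with
    | zero => simp
    | add p q hp hq => simp_all
    | tmul p q =>
      simp only [comulRight, AlgHom.comp_apply, Algebra.TensorProduct.map_tmul,
        Bialgebra.comulAlgHom_apply, hj, AlgHom.id_apply]
      generalize Coalgebra.comul (R := k) q = w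
      induction w with
      | zero => simp
      | tmul p q => simp
      | add p q hp hq => simp_all [TensorProduct.tmul_add]
  · intro w
    induction w with
    | zero => simp
    | add p q hp hq => simp_all
    | tmul p q =>
      simp only [comulLeft, AlgHom.comp_apply, Algebra.TensorProduct.map_tmul,
        Bialgebra.comulAlgHom_apply, AlgHom.id_apply]
      generalize Coalgebra.comul (R := k) p = w
      induction w with
      | zero => simp
      | tmul p q => simp
      | add p q hp hq => simp_all [TensorProduct.add_tmul]
  · intro w
    simp [inclRight]
  · rw [comulLeft_one_tmul]
  · simp [inclRight]
  · rw [comulRight_one_tmul]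

/-- The projection to the elements of degree at most one. -/
noncomputable def projTwo (h : IsOreHom j x σ δ) : B →ₗ[k] B :=
  j.toLinearMap ∘ₗ Finsupp.lapply 0 ∘ₗ h.coeff.toLinearMap +
    LinearMap.mulRight k x ∘ₗ j.toLinearMap ∘ₗ Finsupp.lapply 1 ∘ₗ h.coeff.toLinearMap

theorem projTwo_apply (h : IsOreHom j x σ δ) (y : B) :
    h.projTwo y = j (h.coeff y 0) + j (h.coeff y 1) * x := rfl

theorem projTwo_of_lt (h : IsOreHom j x σ δ) {i : ℕ} (hi : i < 2) (r : R) :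
    h.projTwo (j r * x ^ i) = j r * x ^ i := by
  rw [projTwo_apply, h.coeff_mul_pow]
  interval_cases i <;> simp

/-- The element `u` is fixed by the projection to degree at most one in either factor, so it equals
its image under both projections; that image is expanded on pure tensors. -/
theorem exists_expansion (h : IsOreHom j x σ δ) {u : B ⊗[k] B}
    (h1 : u ∈ oreDegLT (Algebra.TensorProduct.map j (AlgHom.id k B)) (x ⊗ₜ[k] (1 : B)) 2)
    (h2 : u ∈ oreDegLT (Algebra.TensorProduct.map (AlgHom.id k B) j) ((1 : B) ⊗ₜ[k] x) 2) :
    ∃ w t s v : R ⊗[k] R, u = Algebra.TensorProduct.map j j w +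
      Algebra.TensorProduct.map j j t * (x ⊗ₜ[k] 1) +
      Algebra.TensorProduct.map j j s * (1 ⊗ₜ[k] x) +
      Algebra.TensorProduct.map j j v * (x ⊗ₜ[k] x) := by
  have e1 : LinearMap.rTensor B h.projTwo u = u := by
    have : oreDegLT (Algebra.TensorProduct.map j (AlgHom.id k B)) (x ⊗ₜ[k] (1 : B)) 2 ≤
        LinearMap.eqLocus (LinearMap.rTensor B h.projTwo) LinearMap.id := by
      refine oreDegLT_le fun i hi r => ?_
      induction r with
      | zero => simp
      | add p q hp hq =>
        rw [map_add, add_mul]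
        exact add_mem hp hq
      | tmul p q => simp [h.projTwo_of_lt hi]
    exact this h1
  have e2 : LinearMap.lTensor B h.projTwo u = u := by
    have : oreDegLT (Algebra.TensorProduct.map (AlgHom.id k B) j) ((1 : B) ⊗ₜ[k] x) 2 ≤
        LinearMap.eqLocus (LinearMap.lTensor B h.projTwo) LinearMap.id := by
      refine oreDegLT_le fun i hi r => ?_
      induction r with
      | zero => simp
      | add p q hp hq =>
        rw [map_add, add_mul]
        exact add_mem hp hq
      | tmul p q => simp [h.projTwo_of_lt hi]
    exact this h2
  have key : ∀ u, ∃ w t s v : R ⊗[k] R,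
      LinearMap.rTensor B h.projTwo (LinearMap.lTensor B h.projTwo u) =
      Algebra.TensorProduct.map j j w +
      Algebra.TensorProduct.map j j t * (x ⊗ₜ[k] 1) +
      Algebra.TensorProduct.map j j s * (1 ⊗ₜ[k] x) +
      Algebra.TensorProduct.map j j v * (x ⊗ₜ[k] x) := by
    intro u
    induction u with
    | zero => exact ⟨0, 0, 0, 0, by simp⟩
    | add p q hp hq =>
      obtain ⟨w, t, s, v, e⟩ := hp
      obtain ⟨w', t', s', v', e'⟩ := hq
      refine ⟨w + w', t + t', s + s', v + v', ?_⟩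
      simp only [map_add, e, e', add_mul]
      abel
    | tmul p q =>
      refine ⟨h.coeff p 0 ⊗ₜ h.coeff q 0, h.coeff p 1 ⊗ₜ h.coeff q 0, h.coeff p 0 ⊗ₜ h.coeff q 1,
        h.coeff p 1 ⊗ₜ h.coeff q 1, ?_⟩
      simp only [LinearMap.lTensor_tmul, LinearMap.rTensor_tmul, projTwo_apply, map_add,
        TensorProduct.add_tmul, TensorProduct.tmul_add, Algebra.TensorProduct.map_tmul,
        Algebra.TensorProduct.tmul_mul_tmul, mul_one]
      abel
  obtain ⟨w, t, s, v, e⟩ := key u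
  exact ⟨w, t, s, v, by rw [← e, e2, e1]⟩

/-- Freeness is used in one tensor factor at a time. With `x_i` for `x` in the `i`-th factor, the
coefficients are ordered as those of `1, x₁, x₂, x₃, x₁x₂, x₁x₃, x₂x₃, x₁x₂x₃`. -/
theorem expansion_inj (h : IsOreHom j x σ δ) (c c' : Fin 8 → R ⊗[k] (R ⊗[k] R))
    (J : R ⊗[k] (R ⊗[k] R) →ₐ[k] B ⊗[k] (B ⊗[k] B))
    (hJ : J = Algebra.TensorProduct.map j (Algebra.TensorProduct.map j j))
    (e : J (c 0) + J (c 1) * (x ⊗ₜ[k] (1 ⊗ₜ[k] 1)) + J (c 2) * (1 ⊗ₜ[k] (x ⊗ₜ[k] 1)) +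
        J (c 3) * (1 ⊗ₜ[k] (1 ⊗ₜ[k] x)) + J (c 4) * (x ⊗ₜ[k] (x ⊗ₜ[k] 1)) +
        J (c 5) * (x ⊗ₜ[k] (1 ⊗ₜ[k] x)) + J (c 6) * (1 ⊗ₜ[k] (x ⊗ₜ[k] x)) +
        J (c 7) * (x ⊗ₜ[k] (x ⊗ₜ[k] x)) =
      J (c' 0) + J (c' 1) * (x ⊗ₜ[k] (1 ⊗ₜ[k] 1)) + J (c' 2) * (1 ⊗ₜ[k] (x ⊗ₜ[k] 1)) +
        J (c' 3) * (1 ⊗ₜ[k] (1 ⊗ₜ[k] x)) + J (c' 4) * (x ⊗ₜ[k] (x ⊗ₜ[k] 1)) +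
        J (c' 5) * (x ⊗ₜ[k] (1 ⊗ₜ[k] x)) + J (c' 6) * (1 ⊗ₜ[k] (x ⊗ₜ[k] x)) +
        J (c' 7) * (x ⊗ₜ[k] (x ⊗ₜ[k] x))) : c = c' := by
  have h1 := h.rTensor (B ⊗[k] B)
  have h2 := (h.rTensor B).lTensor R
  have h3 := (h.lTensor R).lTensor R
  set l1 := Algebra.TensorProduct.map j (AlgHom.id k (B ⊗[k] B)) with hl1
  set l2 := Algebra.TensorProduct.map (AlgHom.id k R)
    (Algebra.TensorProduct.map j (AlgHom.id k B)) with hl2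
  set l3 := Algebra.TensorProduct.map (AlgHom.id k R)
    (Algebra.TensorProduct.map (AlgHom.id k R) j) with hl3
  have hJl : ∀ a, J a = l1 (l2 (l3 a)) := by
    intro a
    have : J = l1.comp (l2.comp l3) := by
      rw [hJ, hl1, hl2, hl3]
      ext <;> simp
    rw [this]
    rfl
  have key : ∀ c : Fin 8 → R ⊗[k] (R ⊗[k] R),
      J (c 0) + J (c 1) * (x ⊗ₜ[k] (1 ⊗ₜ[k] 1)) + J (c 2) * (1 ⊗ₜ[k] (x ⊗ₜ[k] 1)) +
        J (c 3) * (1 ⊗ₜ[k] (1 ⊗ₜ[k] x)) + J (c 4) * (x ⊗ₜ[k] (x ⊗ₜ[k] 1)) +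
        J (c 5) * (x ⊗ₜ[k] (1 ⊗ₜ[k] x)) + J (c 6) * (1 ⊗ₜ[k] (x ⊗ₜ[k] x)) +
        J (c 7) * (x ⊗ₜ[k] (x ⊗ₜ[k] x)) =
      l1 (l2 (l3 (c 0) + l3 (c 3) * (1 ⊗ₜ[k] (1 ⊗ₜ[k] x))) +
          l2 (l3 (c 2) + l3 (c 6) * (1 ⊗ₜ[k] (1 ⊗ₜ[k] x))) * (1 ⊗ₜ[k] (x ⊗ₜ[k] 1))) +
      l1 (l2 (l3 (c 1) + l3 (c 5) * (1 ⊗ₜ[k] (1 ⊗ₜ[k] x))) +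
          l2 (l3 (c 4) + l3 (c 7) * (1 ⊗ₜ[k] (1 ⊗ₜ[k] x))) * (1 ⊗ₜ[k] (x ⊗ₜ[k] 1))) *
        (x ⊗ₜ[k] 1) := by
    intro c
    have m2 : l2 (1 ⊗ₜ[k] (1 ⊗ₜ[k] x)) = 1 ⊗ₜ[k] (1 ⊗ₜ[k] x) := by simp [hl2]
    have m1 : ∀ y : B ⊗[k] B, l1 (1 ⊗ₜ[k] y) = 1 ⊗ₜ[k] y := by simp [hl1]
    simp only [hJl, map_add, map_mul, m1, m2, add_mul, mul_assoc,
      Algebra.TensorProduct.tmul_mul_tmul, one_mul, mul_one, Algebra.TensorProduct.one_def]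
    abel
  rw [key, key] at e
  obtain ⟨e0, e1⟩ := h1.add_mul_inj e
  obtain ⟨e00, e01⟩ := h2.add_mul_inj e0
  obtain ⟨e10, e11⟩ := h2.add_mul_inj e1
  obtain ⟨f0, f3⟩ := h3.add_mul_inj e00
  obtain ⟨f2, f6⟩ := h3.add_mul_inj e01
  obtain ⟨f1, f5⟩ := h3.add_mul_inj e10
  obtain ⟨f4, f7⟩ := h3.add_mul_inj e11
  funext i
  fin_cases i <;> assumption

/-- The consequences of coassociativity for the coefficients of `Δ(x)`. -/
theorem comul_coeff_relations (h : IsOreHom j x σ δ) (hj : ∀ r, Coalgebra.comul (R := k) (j r) =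
      Algebra.TensorProduct.map j j (Coalgebra.comul (R := k) r)) {w t s v : R ⊗[k] R}
    (hx : Coalgebra.comul (R := k) x = Algebra.TensorProduct.map j j w +
      Algebra.TensorProduct.map j j t * (x ⊗ₜ[k] 1) +
      Algebra.TensorProduct.map j j s * (1 ⊗ₜ[k] x) +
      Algebra.TensorProduct.map j j v * (x ⊗ₜ[k] x)) :
    comulLeft k R t * inclLeft k R t = comulRight k R t + comulRight k R v * inclRight k R w ∧
    comulLeft k R s + comulLeft k R v * inclLeft k R w = comulRight k R s * inclRight k R s ∧
    comulLeft k R v * inclLeft k R t = comulRight k R v * inclRight k R s ∧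
    comulLeft k R v * inclLeft k R v = comulRight k R v * inclRight k R v := by
  have hco := comulLeft_comul k x
  have sx : x ⊗ₜ[k] x = (x ⊗ₜ[k] (1 : B)) * (1 ⊗ₜ[k] x) := by simp
  have i1 : inclLeft k B (x ⊗ₜ[k] 1) = x ⊗ₜ[k] (1 ⊗ₜ[k] 1) := by simp [inclLeft]
  have i2 : inclLeft k B (1 ⊗ₜ[k] x) = 1 ⊗ₜ[k] (x ⊗ₜ[k] 1) := by simp [inclLeft]
  have i3 : inclRight k B (x ⊗ₜ[k] 1) = 1 ⊗ₜ[k] (x ⊗ₜ[k] 1) := by simp [inclRight]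
  have i4 : inclRight k B (1 ⊗ₜ[k] x) = 1 ⊗ₜ[k] (1 ⊗ₜ[k] x) := by simp [inclRight]
  have cx : ∀ y : B ⊗[k] B, (x ⊗ₜ[k] (1 ⊗ₜ[k] 1)) * inclRight k B y =
      inclRight k B y * (x ⊗ₜ[k] (1 ⊗ₜ[k] 1)) := by
    intro y
    simp [inclRight, ← Algebra.TensorProduct.one_def]
  have e1 : comulLeft k B (Coalgebra.comul (R := k) x) =
      comulLeft k B (Algebra.TensorProduct.map j j w) +
      comulLeft k B (Algebra.TensorProduct.map j j t) *
        inclLeft k B (Coalgebra.comul (R := k) x) +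
      comulLeft k B (Algebra.TensorProduct.map j j s) * (1 ⊗ₜ[k] (1 ⊗ₜ[k] x)) +
      comulLeft k B (Algebra.TensorProduct.map j j v) *
        inclLeft k B (Coalgebra.comul (R := k) x) * (1 ⊗ₜ[k] (1 ⊗ₜ[k] x)) := by
    -- Only the outer `Δ(x)` is expanded, so that `(Δ ⊗ id)(x ⊗ 1)` can be written as `Δ(x) ⊗ 1`
    -- before the second expansion.
    conv_lhs => rw [hx]
    rw [sx]
    simp only [map_add, map_mul, comulLeft_tmul_one, comulLeft_one_tmul, mul_assoc]
  have e2 : comulRight k B (Coalgebra.comul (R := k) x) =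
      comulRight k B (Algebra.TensorProduct.map j j w) +
      comulRight k B (Algebra.TensorProduct.map j j t) * (x ⊗ₜ[k] (1 ⊗ₜ[k] 1)) +
      comulRight k B (Algebra.TensorProduct.map j j s) *
        inclRight k B (Coalgebra.comul (R := k) x) +
      comulRight k B (Algebra.TensorProduct.map j j v) *
        inclRight k B (Coalgebra.comul (R := k) x) * (x ⊗ₜ[k] (1 ⊗ₜ[k] 1)) := by
    conv_lhs => rw [hx]
    rw [sx]
    simp only [map_add, map_mul, comulRight_tmul_one, comulRight_one_tmul, mul_assoc, cx]
  rw [e1, e2, hx, sx] at hco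
  simp only [map_add, map_mul, i1, i2, i3, i4, comulLeft_map hj, comulRight_map hj, inclLeft_map,
    inclRight_map] at hco
  have key := h.expansion_inj
    ![comulLeft k R w + comulLeft k R t * inclLeft k R w, comulLeft k R t * inclLeft k R t,
      comulLeft k R t * inclLeft k R s, comulLeft k R s + comulLeft k R v * inclLeft k R w,
      comulLeft k R t * inclLeft k R v, comulLeft k R v * inclLeft k R t,
      comulLeft k R v * inclLeft k R s, comulLeft k R v * inclLeft k R v]
    ![comulRight k R w + comulRight k R s * inclRight k R w,
      comulRight k R t + comulRight k R v * inclRight k R w,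
      comulRight k R s * inclRight k R t, comulRight k R s * inclRight k R s,
      comulRight k R v * inclRight k R t, comulRight k R v * inclRight k R s,
      comulRight k R s * inclRight k R v, comulRight k R v * inclRight k R v] _ rfl (by
    simp only [Matrix.cons_val, map_add, map_mul]
    convert hco using 1
    · simp only [mul_add, add_mul, mul_assoc, Algebra.TensorProduct.tmul_mul_tmul, one_mul, mul_one]
      abel
    · simp only [mul_add, add_mul, mul_assoc, Algebra.TensorProduct.tmul_mul_tmul, one_mul, mul_one]
      abel)
  -- These are the coefficients of `x₁`, `x₃`, `x₁x₃` and `x₁x₂x₃`.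
  exact ⟨congrFun key 1, congrFun key 3, congrFun key 5, congrFun key 7⟩

end IsOreHom

end Cube

/-! ### Symbols of the coefficients of the comultiplication -/

section Cocycle

open MvPolynomial

variable {k : Type*} [Field k] {ι : Type*}

/-- `V(Y, Z) ↦ V(X, Y)`. -/
noncomputable def symInclLeft : MvPolynomial (ι ⊕ ι) k →ₐ[k] MvPolynomial (ι ⊕ (ι ⊕ ι)) k :=
  aeval (Sum.elim (fun i => X (Sum.inl i)) (fun i => X (Sum.inr (Sum.inl i))))

/-- `V(Y, Z) ↦ V(Y, Z)`. -/
noncomputable def symInclRight : MvPolynomial (ι ⊕ ι) k →ₐ[k] MvPolynomial (ι ⊕ (ι ⊕ ι)) k :=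
  aeval (Sum.elim (fun i => X (Sum.inr (Sum.inl i))) (fun i => X (Sum.inr (Sum.inr i))))

/-- `V(Y, Z) ↦ V(X + Y, Z)`. -/
noncomputable def symComulLeft : MvPolynomial (ι ⊕ ι) k →ₐ[k] MvPolynomial (ι ⊕ (ι ⊕ ι)) k :=
  aeval (Sum.elim (fun i => X (Sum.inl i) + X (Sum.inr (Sum.inl i)))
    (fun i => X (Sum.inr (Sum.inr i))))

/-- `V(Y, Z) ↦ V(X, Y + Z)`. -/
noncomputable def symComulRight : MvPolynomial (ι ⊕ ι) k →ₐ[k] MvPolynomial (ι ⊕ (ι ⊕ ι)) k :=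
  aeval (Sum.elim (fun i => X (Sum.inl i))
    (fun i => X (Sum.inr (Sum.inl i)) + X (Sum.inr (Sum.inr i))))

/-- The substitution of `f`, `g`, `h` for the three groups of variables. -/
noncomputable def subst3 (f g h : ι → MvPolynomial (ι ⊕ ι) k) :
    MvPolynomial (ι ⊕ (ι ⊕ ι)) k →ₐ[k] MvPolynomial (ι ⊕ ι) k :=
  aeval (Sum.elim f (Sum.elim g h))

/-- The substitution of `f`, `g` for the two groups of variables. -/
noncomputable def subst2 (f g : ι → MvPolynomial (ι ⊕ ι) k) :
    MvPolynomial (ι ⊕ ι) k →ₐ[k] MvPolynomial (ι ⊕ ι) k :=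
  aeval (Sum.elim f g)

theorem subst3_symInclLeft (f g h : ι → MvPolynomial (ι ⊕ ι) k) (V : MvPolynomial (ι ⊕ ι) k) :
    subst3 f g h (symInclLeft V) = subst2 f g V := by
  have : (subst3 f g h).comp symInclLeft = subst2 f g := by
    ext (i | i) : 1 <;> simp [subst3, symInclLeft, subst2]
  exact DFunLike.congr_fun this V

theorem subst3_symInclRight (f g h : ι → MvPolynomial (ι ⊕ ι) k) (V : MvPolynomial (ι ⊕ ι) k) :
    subst3 f g h (symInclRight V) = subst2 g h V := by
  have : (subst3 f g h).comp symInclRight = subst2 g h := by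
    ext (i | i) : 1 <;> simp [subst3, symInclRight, subst2]
  exact DFunLike.congr_fun this V

theorem subst3_symComulLeft (f g h : ι → MvPolynomial (ι ⊕ ι) k) (V : MvPolynomial (ι ⊕ ι) k) :
    subst3 f g h (symComulLeft V) = subst2 (f + g) h V := by
  have : (subst3 f g h).comp symComulLeft = subst2 (f + g) h := by
    ext (i | i) : 1 <;> simp [subst3, symComulLeft, subst2]
  exact DFunLike.congr_fun this V

theorem subst3_symComulRight (f g h : ι → MvPolynomial (ι ⊕ ι) k) (V : MvPolynomial (ι ⊕ ι) k) :
    subst3 f g h (symComulRight V) = subst2 f (g + h) V := by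
  have : (subst3 f g h).comp symComulRight = subst2 f (g + h) := by
    ext (i | i) : 1 <;> simp [subst3, symComulRight, subst2]
  exact DFunLike.congr_fun this V

theorem subst2_subst2 (f g f' g' : ι → MvPolynomial (ι ⊕ ι) k) (V : MvPolynomial (ι ⊕ ι) k) :
    subst2 f' g' (subst2 f g V) =
      subst2 (fun i => subst2 f' g' (f i)) (fun i => subst2 f' g' (g i)) V := by
  have : (subst2 f' g').comp (subst2 f g) =
      subst2 (fun i => subst2 f' g' (f i)) (fun i => subst2 f' g' (g i)) := by
    ext (i | i) : 1 <;> simp [subst2]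
  exact DFunLike.congr_fun this V

theorem subst2_X (V : MvPolynomial (ι ⊕ ι) k) :
    subst2 (fun i => X (Sum.inl i)) (fun i => X (Sum.inr i)) V = V := by
  have : subst2 (fun i => X (Sum.inl i)) (fun i => X (Sum.inr i)) =
      AlgHom.id k (MvPolynomial (ι ⊕ ι) k) := by
    ext (i | i) : 1 <;> simp [subst2]
  exact DFunLike.congr_fun this V

theorem subst2_X_inl (f g : ι → MvPolynomial (ι ⊕ ι) k) (i : ι) :
    subst2 f g (X (Sum.inl i)) = f i := by simp [subst2]

theorem subst2_X_inr (f g : ι → MvPolynomial (ι ⊕ ι) k) (i : ι) :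
    subst2 f g (X (Sum.inr i)) = g i := by simp [subst2]

theorem symComulLeft_ne_zero {V : MvPolynomial (ι ⊕ ι) k} (hV : V ≠ 0) :
    symComulLeft V ≠ 0 := by
  intro h
  have := subst3_symComulLeft (fun i => X (Sum.inl i)) 0 (fun i => X (Sum.inr i)) V
  rw [h, map_zero, add_zero, subst2_X] at this
  exact hV this.symm

theorem symComulRight_ne_zero {V : MvPolynomial (ι ⊕ ι) k} (hV : V ≠ 0) :
    symComulRight V ≠ 0 := by
  intro h
  have := subst3_symComulRight (fun i => X (Sum.inl i)) 0 (fun i => X (Sum.inr i)) V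
  rw [h, map_zero, zero_add, subst2_X] at this
  exact hV this.symm

theorem symInclLeft_ne_zero {V : MvPolynomial (ι ⊕ ι) k} (hV : V ≠ 0) :
    symInclLeft V ≠ 0 := by
  intro h
  have := subst3_symInclLeft (fun i => X (Sum.inl i)) (fun i => X (Sum.inr i)) 0 V
  rw [h, map_zero, subst2_X] at this
  exact hV this.symm

theorem symInclRight_ne_zero {V : MvPolynomial (ι ⊕ ι) k} (hV : V ≠ 0) :
    symInclRight V ≠ 0 := by
  intro h
  have := subst3_symInclRight 0 (fun i => X (Sum.inl i)) (fun i => X (Sum.inr i)) V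
  rw [h, map_zero, subst2_X] at this
  exact hV this.symm

/-- A non-zero multiplicative polynomial two-cocycle `V` of the additive group does not vanish
at the origin. -/
theorem constantCoeff_ne_zero_of_cocycle {V : MvPolynomial (ι ⊕ ι) k} (hV : V ≠ 0)
    (h : symComulLeft V * symInclLeft V = symComulRight V * symInclRight V) :
    constantCoeff V ≠ 0 := by
  intro h0
  -- Putting `X = 0` and cancelling `V(Y, Z)` leaves `V(0, Y) = V(0, Y + Z)`.
  have e1 := congrArg (subst3 0 (fun i => X (Sum.inl i)) (fun i => X (Sum.inr i))) h
  rw [map_mul, map_mul, subst3_symComulLeft, subst3_symInclLeft, subst3_symComulRight,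
    subst3_symInclRight, zero_add, subst2_X, mul_comm] at e1
  -- Now `Y = 0` gives `V(0, 0) = V(0, Z)`, which is zero by assumption.
  have e2 := congrArg (subst2 0 (fun i => X (Sum.inr i))) (mul_right_cancel₀ hV e1)
  rw [subst2_subst2, subst2_subst2] at e2
  have e3 : subst2 (fun _ => 0) (fun _ => 0) V = 0 := by
    have : (subst2 (fun _ => 0) (fun _ => 0) : MvPolynomial (ι ⊕ ι) k →ₐ[k] _) =
        (Algebra.ofId k _).comp (aeval fun _ => 0) := by
      ext (i | i) : 1 <;> simp [subst2]
    rw [this, AlgHom.comp_apply]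
    simp [aeval_zero', h0]
  simp only [Pi.zero_apply, map_zero, Pi.add_apply, map_add, subst2_X_inl, subst2_X_inr,
    zero_add] at e2
  rw [e3] at e2
  -- The point `(Y, -Y, Z)` turns the first factor into `V(0, Z) = 0`, so `V(Y, Z - Y) V(-Y, Z) =
  -- 0`. Each factor differs from `V` by an invertible substitution.
  have e4 := congrArg (subst3 (fun i => X (Sum.inl i)) (fun i => - X (Sum.inl i))
    (fun i => X (Sum.inr i))) h
  rw [map_mul, map_mul, subst3_symComulLeft, subst3_symInclLeft, subst3_symComulRight,
    subst3_symInclRight] at e4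
  have e5 : ((fun i => X (Sum.inl i)) + fun i => - X (Sum.inl i) :
      ι → MvPolynomial (ι ⊕ ι) k) = fun _ => 0 := by
    funext i
    simp
  rw [e5, ← e2, zero_mul] at e4
  rcases mul_eq_zero.1 e4.symm with e | e
  · have := congrArg (subst2 (fun i => X (Sum.inl i)) (fun i => X (Sum.inr i) + X (Sum.inl i))) e
    rw [subst2_subst2, map_zero] at this
    simp only [Pi.add_apply, map_add, map_neg, subst2_X_inl, subst2_X_inr,
      neg_add_cancel_comm_assoc, subst2_X] at this
    exact hV this
  · have := congrArg (subst2 (fun i => - X (Sum.inl i)) (fun i => X (Sum.inr i))) e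
    rw [subst2_subst2, map_zero] at this
    simp only [map_neg, subst2_X_inl, subst2_X_inr, neg_neg, subst2_X] at this
    exact hV this

end Cocycle

/-! ### Weight arguments that force the coefficients of `Δ(x)` to be scalars. -/

theorem exists_smul_one_of_mem_pbwLT_one {k : Type*} [Field k] {ι A : Type*} [Ring A]
    [Algebra k A] {b : Module.Basis (ι →₀ ℕ) k A} {d : ι → ℕ} (h : IsPBWDeformation b d)
    (hd : ∀ i, 0 < d i) {a : A} (ha : a ∈ pbwLT b d 1) : ∃ c : k, a = c • 1 := by
  have : pbwLT b d 1 ≤ Submodule.span k {1} := by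
    refine pbwLT_le fun m hm => ?_
    have : Finsupp.NonTorsionWeight ℕ d := Finsupp.nonTorsionWeight_of ℕ _ fun i => (hd i).ne'
    have h0 : m = 0 := (Finsupp.weight_eq_zero_iff_eq_zero d).1 (by omega)
    rw [h0, h.one]
    exact Submodule.mem_span_singleton_self 1
  obtain ⟨c, hc⟩ := Submodule.mem_span_singleton.1 (this ha)
  exact ⟨c, hc.symm⟩

section Primitive

variable {k : Type*} [Field k] {ι : Type*} {R : Type*} [Ring R] [Bialgebra k R]
  {b : Module.Basis (ι →₀ ℕ) k R} {d : ι → ℕ}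

theorem sumElim_pos {ι ι' : Type*} {d : ι → ℕ} {d' : ι' → ℕ} (h : ∀ i, 0 < d i)
    (h' : ∀ i, 0 < d' i) : ∀ i, 0 < Sum.elim d d' i := by
  rintro (i | i)
  exacts [h i, h' i]

theorem mem_pbwLT_of_eq_generator {ι A : Type*} [Ring A] [Algebra k A]
    {b : Module.Basis (ι →₀ ℕ) k A} {d : ι → ℕ} {a : A} {i : ι} {r : ℕ}
    (e : a = b (Finsupp.single i 1)) (hr : r = d i) : a ∈ pbwLT b d (r + 1) := by
  rw [e, hr]
  exact generator_mem_pbwLT i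

theorem pbwSymbol_of_eq_generator {ι A : Type*} [Ring A] [Algebra k A]
    {b : Module.Basis (ι →₀ ℕ) k A} {d : ι → ℕ} {a : A} {i : ι} {r : ℕ}
    {p : MvPolynomial ι k} (e : a = b (Finsupp.single i 1)) (hr : r = d i)
    (hp : p = MvPolynomial.X i) : pbwSymbol b d r a = p := by
  rw [e, hr, hp]
  exact pbwSymbol_generator i

theorem isSymbolHom_inclLeft (h : IsPBWDeformation b d) (hd : ∀ i, 0 < d i) :
    IsSymbolHom (pbwTensor b b) (Sum.elim d d) (pbwTensor b (pbwTensor b b))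
      (Sum.elim d (Sum.elim d d)) (inclLeft k R) symInclLeft := by
  have e1 : ∀ i, inclLeft k R (pbwTensor b b (Finsupp.single (Sum.inl i) 1)) =
      pbwTensor b (pbwTensor b b) (Finsupp.single (Sum.inl i) 1) := fun i => by
    rw [pbwTensor_single_inl h, pbwTensor_single_inl (h.tensor h)]
    simp [inclLeft, Algebra.TensorProduct.one_def]
  have e2 : ∀ i, inclLeft k R (pbwTensor b b (Finsupp.single (Sum.inr i) 1)) =
      pbwTensor b (pbwTensor b b) (Finsupp.single (Sum.inr (Sum.inl i)) 1) := fun i => by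
    rw [pbwTensor_single_inr h, pbwTensor_single_inr h, pbwTensor_single_inl h]
    simp [inclLeft]
  refine .of_generators (h.tensor h) (sumElim_pos hd hd) (h.tensor (h.tensor h)) _ _ ?_ ?_
  · rintro (i | i)
    · exact mem_pbwLT_of_eq_generator (e1 i) rfl
    · exact mem_pbwLT_of_eq_generator (e2 i) rfl
  · rintro (i | i)
    · exact pbwSymbol_of_eq_generator (e1 i) rfl (by simp [symInclLeft])
    · exact pbwSymbol_of_eq_generator (e2 i) rfl (by simp [symInclLeft])

theorem isSymbolHom_inclRight (h : IsPBWDeformation b d) (hd : ∀ i, 0 < d i) :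
    IsSymbolHom (pbwTensor b b) (Sum.elim d d) (pbwTensor b (pbwTensor b b))
      (Sum.elim d (Sum.elim d d)) (inclRight k R) symInclRight := by
  have e1 : ∀ i, inclRight k R (pbwTensor b b (Finsupp.single i 1)) =
      pbwTensor b (pbwTensor b b) (Finsupp.single (Sum.inr i) 1) := fun i => by
    rw [pbwTensor_single_inr h]
    simp [inclRight]
  refine .of_generators (h.tensor h) (sumElim_pos hd hd) (h.tensor (h.tensor h)) _ _ ?_ ?_
  · intro i
    exact mem_pbwLT_of_eq_generator (e1 i) rfl
  · intro i
    refine pbwSymbol_of_eq_generator (e1 i) rfl ?_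
    rcases i with i | i <;> simp [symInclRight]

/-- The generators of `R` are primitive up to terms of lower weight. -/
def IsPrimitiveMod (b : Module.Basis (ι →₀ ℕ) k R) (d : ι → ℕ) : Prop :=
  ∀ i, Coalgebra.comul (R := k) (b (Finsupp.single i 1)) -
    (b (Finsupp.single i 1) ⊗ₜ[k] 1 + 1 ⊗ₜ[k] b (Finsupp.single i 1)) ∈
      pbwLT (pbwTensor b b) (Sum.elim d d) (d i)

/-- On symbols the comultiplication becomes that of the additive group, which reduces identities in
`R ⊗ R ⊗ R` to identities of commutative polynomials. -/
theorem isSymbolHom_comul (h : IsPBWDeformation b d) (hd : ∀ i, 0 < d i)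
    (hp : IsPrimitiveMod b d) :
    IsSymbolHom b d (pbwTensor b b) (Sum.elim d d) (Bialgebra.comulAlgHom k R)
      (MvPolynomial.aeval fun i => MvPolynomial.X (Sum.inl i) + MvPolynomial.X (Sum.inr i)) := by
  refine .of_generators h hd (h.tensor h) _ _ (fun i => ?_) (fun i => ?_)
  · have h1 := pbwLT_mono (Nat.le_succ _) (hp i)
    have h2 := generator_mem_pbwLT (b := pbwTensor b b) (d := Sum.elim d d) (Sum.inl i)
    have h3 := generator_mem_pbwLT (b := pbwTensor b b) (d := Sum.elim d d) (Sum.inr i)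
    rw [pbwTensor_single_inl h] at h2
    rw [pbwTensor_single_inr h] at h3
    have := add_mem h1 (add_mem h2 h3)
    simpa using this
  · have h1 := pbwSymbol_eq_zero le_rfl (hp i)
    have h2 := pbwSymbol_generator (b := pbwTensor b b) (d := Sum.elim d d) (Sum.inl i)
    have h3 := pbwSymbol_generator (b := pbwTensor b b) (d := Sum.elim d d) (Sum.inr i)
    rw [pbwTensor_single_inl h, Sum.elim_inl] at h2
    rw [pbwTensor_single_inr h, Sum.elim_inr] at h3
    rw [map_sub, map_add, h2, h3, sub_eq_zero] at h1
    simpa using h1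

theorem isSymbolHom_comulLeft (h : IsPBWDeformation b d) (hd : ∀ i, 0 < d i)
    (hp : IsPrimitiveMod b d) :
    IsSymbolHom (pbwTensor b b) (Sum.elim d d) (pbwTensor b (pbwTensor b b))
      (Sum.elim d (Sum.elim d d)) (comulLeft k R) symComulLeft := by
  have hc := (isSymbolHom_inclLeft h hd).comp (isSymbolHom_comul h hd hp)
  have e1 : ∀ i, comulLeft k R (pbwTensor b b (Finsupp.single (Sum.inl i) 1)) =
      (inclLeft k R).comp (Bialgebra.comulAlgHom k R) (b (Finsupp.single i 1)) := fun i => by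
    rw [pbwTensor_single_inl h, comulLeft_tmul_one]
    rfl
  have e2 : ∀ i, comulLeft k R (pbwTensor b b (Finsupp.single (Sum.inr i) 1)) =
      pbwTensor b (pbwTensor b b) (Finsupp.single (Sum.inr (Sum.inr i)) 1) := fun i => by
    rw [pbwTensor_single_inr h, pbwTensor_single_inr h, pbwTensor_single_inr h, comulLeft_one_tmul]
  refine .of_generators (h.tensor h) (sumElim_pos hd hd) (h.tensor (h.tensor h)) _ _ ?_ ?_
  · rintro (i | i)
    · rw [e1]
      exact hc.mem _ _ (generator_mem_pbwLT _)
    · exact mem_pbwLT_of_eq_generator (e2 i) rfl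
  · rintro (i | i)
    · rw [e1, Sum.elim_inl, hc.symbol _ _ (generator_mem_pbwLT _), pbwSymbol_generator]
      simp [symInclLeft, symComulLeft]
    · exact pbwSymbol_of_eq_generator (e2 i) rfl (by simp [symComulLeft])

theorem isSymbolHom_comulRight (h : IsPBWDeformation b d) (hd : ∀ i, 0 < d i)
    (hp : IsPrimitiveMod b d) :
    IsSymbolHom (pbwTensor b b) (Sum.elim d d) (pbwTensor b (pbwTensor b b))
      (Sum.elim d (Sum.elim d d)) (comulRight k R) symComulRight := by
  have hc := (isSymbolHom_inclRight h hd).comp (isSymbolHom_comul h hd hp)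
  have e1 : ∀ i, comulRight k R (pbwTensor b b (Finsupp.single (Sum.inr i) 1)) =
      (inclRight k R).comp (Bialgebra.comulAlgHom k R) (b (Finsupp.single i 1)) := fun i => by
    rw [pbwTensor_single_inr h, comulRight_one_tmul]
    rfl
  have e2 : ∀ i, comulRight k R (pbwTensor b b (Finsupp.single (Sum.inl i) 1)) =
      pbwTensor b (pbwTensor b b) (Finsupp.single (Sum.inl i) 1) := fun i => by
    rw [pbwTensor_single_inl h, pbwTensor_single_inl (h.tensor h), comulRight_tmul_one]
    rfl
  refine .of_generators (h.tensor h) (sumElim_pos hd hd) (h.tensor (h.tensor h)) _ _ ?_ ?_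
  · rintro (i | i)
    · exact mem_pbwLT_of_eq_generator (e2 i) rfl
    · rw [e1]
      exact hc.mem _ _ (generator_mem_pbwLT _)
  · rintro (i | i)
    · exact pbwSymbol_of_eq_generator (e2 i) rfl (by simp [symComulRight])
    · rw [e1, Sum.elim_inr, hc.symbol _ _ (generator_mem_pbwLT _), pbwSymbol_generator]
      simp [symInclRight, symComulRight]

/-- If `t` has exact weight `r`, the left side has exact weight `2 r` and the right side weight at
most `r`, so `r = 0`. -/
theorem scalar_of_comulLeft_mul (h : IsPBWDeformation b d) (hd : ∀ i, 0 < d i)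
    (hp : IsPrimitiveMod b d) {t : R ⊗[k] R}
    (ht : comulLeft k R t * inclLeft k R t = comulRight k R t) : ∃ c : k, t = c • 1 := by
  by_cases ht0 : t = 0
  · exact ⟨0, by simp [ht0]⟩
  obtain ⟨r, hr, hr0⟩ := exists_pbwSymbol_ne_zero (pbwTensor b b) (Sum.elim d d) ht0
  rcases Nat.eq_zero_or_pos r with rfl | hpos
  · exact exists_smul_one_of_mem_pbwLT_one (h.tensor h) (sumElim_pos hd hd) hr
  exfalso
  have hL := isSymbolHom_comulLeft h hd hp
  have hR := isSymbolHom_comulRight h hd hp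
  have hI := isSymbolHom_inclLeft h hd
  have e := (h.tensor (h.tensor h)).symbol_mul (hL.mem _ _ hr) (hI.mem _ _ hr)
  rw [ht, hL.symbol _ _ hr, hI.symbol _ _ hr,
    pbwSymbol_eq_zero (by omega) (hR.mem _ _ hr)] at e
  exact mul_ne_zero (symComulLeft_ne_zero hr0) (symInclLeft_ne_zero hr0) e.symm

theorem scalar_of_comulRight_mul (h : IsPBWDeformation b d) (hd : ∀ i, 0 < d i)
    (hp : IsPrimitiveMod b d) {s : R ⊗[k] R}
    (hs : comulLeft k R s = comulRight k R s * inclRight k R s) : ∃ c : k, s = c • 1 := by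
  by_cases hs0 : s = 0
  · exact ⟨0, by simp [hs0]⟩
  obtain ⟨r, hr, hr0⟩ := exists_pbwSymbol_ne_zero (pbwTensor b b) (Sum.elim d d) hs0
  rcases Nat.eq_zero_or_pos r with rfl | hpos
  · exact exists_smul_one_of_mem_pbwLT_one (h.tensor h) (sumElim_pos hd hd) hr
  exfalso
  have hL := isSymbolHom_comulLeft h hd hp
  have hR := isSymbolHom_comulRight h hd hp
  have hI := isSymbolHom_inclRight h hd
  have e := (h.tensor (h.tensor h)).symbol_mul (hR.mem _ _ hr) (hI.mem _ _ hr)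
  rw [← hs, hR.symbol _ _ hr, hI.symbol _ _ hr,
    pbwSymbol_eq_zero (by omega) (hL.mem _ _ hr)] at e
  exact mul_ne_zero (symComulRight_ne_zero hr0) (symInclRight_ne_zero hr0) e.symm

/-- Both sides have weight `2 r`, so weights alone do not decide. The symbol is a polynomial
cocycle, however, and a homogeneous symbol of positive weight would vanish at the origin. -/
theorem scalar_of_cocycle (h : IsPBWDeformation b d) (hd : ∀ i, 0 < d i)
    (hp : IsPrimitiveMod b d) {t : R ⊗[k] R}
    (ht : comulLeft k R t * inclLeft k R t = comulRight k R t * inclRight k R t) :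
    ∃ c : k, t = c • 1 := by
  by_cases ht0 : t = 0
  · exact ⟨0, by simp [ht0]⟩
  obtain ⟨r, hr, hr0⟩ := exists_pbwSymbol_ne_zero (pbwTensor b b) (Sum.elim d d) ht0
  rcases Nat.eq_zero_or_pos r with rfl | hpos
  · exact exists_smul_one_of_mem_pbwLT_one (h.tensor h) (sumElim_pos hd hd) hr
  exfalso
  have hL := isSymbolHom_comulLeft h hd hp
  have hR := isSymbolHom_comulRight h hd hp
  have hI := isSymbolHom_inclLeft h hd
  have hI' := isSymbolHom_inclRight h hd
  have e := (h.tensor (h.tensor h)).symbol_mul (hL.mem _ _ hr) (hI.mem _ _ hr)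
  rw [ht, (h.tensor (h.tensor h)).symbol_mul (hR.mem _ _ hr) (hI'.mem _ _ hr), hL.symbol _ _ hr,
    hI.symbol _ _ hr, hR.symbol _ _ hr, hI'.symbol _ _ hr] at e
  refine constantCoeff_ne_zero_of_cocycle hr0 e.symm ?_
  rw [MvPolynomial.constantCoeff_eq, coeff_pbwSymbol, if_neg (by simp; omega)]

end Primitive

/-! ### The comultiplication of the new variable, and the automorphism as a winding automorphism. -/

section MainStep

variable {k : Type*} [Field k] {R B : Type*} [Ring R] [Bialgebra k R] [Ring B] [Bialgebra k B]
  {j : R →ₐ[k] B} {x : B} {σ : R ≃ₐ[k] R} {δ : R →ₗ[k] R}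

variable (k) in
/-- The homomorphism `id ⊗ ε : A ⊗ A → A`. -/
noncomputable def counitRight (A : Type*) [Ring A] [Bialgebra k A] : A ⊗[k] A →ₐ[k] A :=
  (Algebra.TensorProduct.rid k k A).toAlgHom.comp
    (Algebra.TensorProduct.map (AlgHom.id k A) (Bialgebra.counitAlgHom k A))

variable (k) in
/-- The homomorphism `ε ⊗ id : A ⊗ A → A`. -/
noncomputable def counitLeft (A : Type*) [Ring A] [Bialgebra k A] : A ⊗[k] A →ₐ[k] A :=
  (Algebra.TensorProduct.lid k A).toAlgHom.comp
    (Algebra.TensorProduct.map (Bialgebra.counitAlgHom k A) (AlgHom.id k A))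

theorem counitRight_comul (a : R) : counitRight k R (Coalgebra.comul (R := k) a) = a := by
  have h := congrArg (TensorProduct.rid k R) (Coalgebra.lTensor_counit_comul (R := k) a)
  rw [TensorProduct.rid_tmul, one_smul] at h
  exact h

theorem counitLeft_comul (a : R) : counitLeft k R (Coalgebra.comul (R := k) a) = a := by
  have h := congrArg (TensorProduct.lid k R) (Coalgebra.rTensor_counit_comul (R := k) a)
  rw [TensorProduct.lid_tmul, one_smul] at h
  exact h

theorem counitRight_tmul (a c : R) :
    counitRight k R (a ⊗ₜ[k] c) = Coalgebra.counit (R := k) c • a := by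
  simp [counitRight]

theorem counitLeft_tmul (a c : R) :
    counitLeft k R (a ⊗ₜ[k] c) = Coalgebra.counit (R := k) a • c := by
  simp [counitLeft]

theorem counitRight_map (hε : ∀ r, Coalgebra.counit (R := k) (j r) = Coalgebra.counit (R := k) r)
    (w : R ⊗[k] R) :
    counitRight k B (Algebra.TensorProduct.map j j w) = j (counitRight k R w) := by
  induction w with
  | zero => simp
  | add p q hp hq => simp_all
  | tmul p q => simp [counitRight_tmul, hε]

theorem counitLeft_map (hε : ∀ r, Coalgebra.counit (R := k) (j r) = Coalgebra.counit (R := k) r)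
    (w : R ⊗[k] R) :
    counitLeft k B (Algebra.TensorProduct.map j j w) = j (counitLeft k R w) := by
  induction w with
  | zero => simp
  | add p q hp hq => simp_all
  | tmul p q => simp [counitLeft_tmul, hε]

/-- Applying the counit to the third factor of `t ⊗ 1 = 1 ⊗ s` determines `t`, and applying it to
the first factor determines `s`. -/
theorem eq_of_inclLeft_eq_inclRight {t s : R ⊗[k] R} (e : inclLeft k R t = inclRight k R s) :
    ∃ g : R, t = 1 ⊗ₜ[k] g ∧ s = g ⊗ₜ[k] 1 := by
  have h1 : ∀ t, Algebra.TensorProduct.map (AlgHom.id k R) (counitRight k R) (inclLeft k R t)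
      = t := by
    intro t
    induction t with
    | zero => simp
    | add p q hp hq => simp_all
    | tmul p q => simp [inclLeft, counitRight_tmul]
  have ht : t = 1 ⊗ₜ[k] counitRight k R s := by
    rw [← h1 t, e]
    simp [inclRight]
  refine ⟨_, ht, ?_⟩
  have h2 := congrArg ((Algebra.TensorProduct.lid k (R ⊗[k] R)).toAlgHom.comp
    (Algebra.TensorProduct.map (Bialgebra.counitAlgHom k R) (AlgHom.id k (R ⊗[k] R)))) e
  rw [ht] at h2
  simpa [inclLeft, inclRight] using h2.symm

namespace IsOreHom

/-- The variable of a Hopf Ore extension is primitive modulo the coefficient Hopf algebra. -/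
theorem comul_variable (h : IsOreHom j x σ δ)
    (hj : ∀ r, Coalgebra.comul (R := k) (j r) =
      Algebra.TensorProduct.map j j (Coalgebra.comul (R := k) r))
    (hε : ∀ r, Coalgebra.counit (R := k) (j r) = Coalgebra.counit (R := k) r)
    (hgl : ∀ y : B, y ≠ 0 → Coalgebra.comul (R := k) y = y ⊗ₜ[k] y → ∃ z, z * y = 1)
    [Nontrivial R] {ι : Type*} {b : Module.Basis (ι →₀ ℕ) k R} {d : ι → ℕ}
    (hb : IsPBWDeformation b d) (hd : ∀ i, 0 < d i) (hp : IsPrimitiveMod b d) :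
    ∃ w : R ⊗[k] R, Coalgebra.comul (R := k) x = Algebra.TensorProduct.map j j w +
      x ⊗ₜ[k] 1 + 1 ⊗ₜ[k] x := by
  have := hb.noZeroDivisors
  have := (hb.tensor (hb.tensor hb)).noZeroDivisors
  obtain ⟨w, t, s, v, hx⟩ := h.exists_expansion (h.comul_mem_left hj) (h.comul_mem_right hj)
  obtain ⟨e1, e3, e13, e123⟩ := h.comul_coeff_relations hj hx
  obtain ⟨c, hc⟩ := scalar_of_cocycle hb hd hp e123
  by_cases hc0 : c = 0
  · have hv : v = 0 := by rw [hc, hc0, zero_smul]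
    rw [hv, map_zero, zero_mul, add_zero] at e1 e3
    obtain ⟨p, hpt⟩ := scalar_of_comulLeft_mul hb hd hp e1
    obtain ⟨q, hqs⟩ := scalar_of_comulRight_mul hb hd hp e3
    rw [hv, hpt, hqs] at hx
    simp only [map_zero, zero_mul, add_zero, map_smul, map_one, smul_mul_assoc, one_mul] at hx
    -- The counit axioms express `x` with leading coefficients `p` and `q`; both must equal that of
    -- `x` itself.
    have hone : j 0 + j 1 * x = x := by simp
    have h1 := congrArg (counitRight k B) hx
    have h2 := congrArg (counitLeft k B) hx
    simp only [counitRight_comul, counitLeft_comul, map_add, map_smul, counitRight_map hε,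
      counitLeft_map hε, counitRight_tmul, counitLeft_tmul, Bialgebra.counit_one, one_smul]
      at h1 h2
    have k1 : j (counitRight k R w + (q * Coalgebra.counit (R := k) x) • 1) + j (p • 1) * x =
        x := by
      rw [map_add, map_smul, map_smul, map_one, mul_smul, smul_mul_assoc, one_mul,
        add_right_comm]
      exact h1.symm
    have k2 : j (counitLeft k R w + (p * Coalgebra.counit (R := k) x) • 1) + j (q • 1) * x =
        x := by
      rw [map_add, map_smul, map_smul, map_one, mul_smul, smul_mul_assoc, one_mul]
      exact h2.symm
    have l1 : p • (1 : R) = (1 : k) • 1 := by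
      rw [one_smul]; exact (h.add_mul_inj (k1.trans hone.symm)).2
    have l2 : q • (1 : R) = (1 : k) • 1 := by
      rw [one_smul]; exact (h.add_mul_inj (k2.trans hone.symm)).2
    have p1 : p = 1 := smul_left_injective k one_ne_zero l1
    have q1 : q = 1 := smul_left_injective k one_ne_zero l2
    exact ⟨w, by rw [hx, p1, q1, one_smul, one_smul]⟩
  · exfalso
    rw [hc] at e13 e1
    simp only [map_smul, map_one, smul_mul_assoc, one_mul] at e13 e1
    -- The relation for `x₁x₃` gives `t = 1 ⊗ g` and `s = g ⊗ 1`, and that for `x₁` gives `Δ(g) + c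
    -- w = g ⊗ g`. Together they make `g + c x` group-like, hence left invertible, contradicting its
    -- degree one in `x`.
    obtain ⟨g, rfl, rfl⟩ := eq_of_inclLeft_eq_inclRight (smul_right_injective _ hc0 e13)
    have hw : Coalgebra.comul (R := k) g + c • w = g ⊗ₜ[k] g := by
      refine includeRight_injective_field k R (R ⊗[k] R) ?_
      rw [comulLeft_one_tmul, comulRight_one_tmul] at e1
      rw [map_add, map_smul]
      refine e1.symm.trans ?_
      simp [inclLeft]
    have hb0 : c • (1 : R) ≠ 0 := smul_ne_zero hc0 one_ne_zero
    have hu : Coalgebra.comul (R := k) (j g + j (c • 1) * x) =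
        (j g + j (c • 1) * x) ⊗ₜ[k] (j g + j (c • 1) * x) := by
      have hw' := congrArg (Algebra.TensorProduct.map j j) hw
      simp only [map_add, map_smul, Algebra.TensorProduct.map_tmul] at hw'
      simp only [map_add, map_smul, map_one, smul_mul_assoc, one_mul, hj, hx, hc,
        smul_add, TensorProduct.add_tmul, TensorProduct.tmul_add, TensorProduct.smul_tmul',
        TensorProduct.tmul_smul, Algebra.TensorProduct.map_tmul,
        Algebra.TensorProduct.tmul_mul_tmul, mul_one, ← hw']
      abel
    have hne : j g + j (c • 1) * x ≠ 0 := by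
      intro h0
      exact hb0 (h.add_mul_inj (h0.trans (by simp : (0 : B) = j 0 + j 0 * x))).2
    obtain ⟨z, hz⟩ := hgl _ hne hu
    exact hb0 (h.eq_zero_of_mul_eq_one hz)

/-- The automorphism of a Hopf Ore extension is a winding automorphism. -/
theorem exists_winding (h : IsOreHom j x σ δ)
    (hj : ∀ r, Coalgebra.comul (R := k) (j r) =
      Algebra.TensorProduct.map j j (Coalgebra.comul (R := k) r)) {w : R ⊗[k] R}
    (hx : Coalgebra.comul (R := k) x = Algebra.TensorProduct.map j j w +
      x ⊗ₜ[k] 1 + 1 ⊗ₜ[k] x) :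
    ∃ χ : R →ₐ[k] k, ∀ r, σ r = (Algebra.TensorProduct.lid k R).toAlgHom.comp
      (Algebra.TensorProduct.map χ (AlgHom.id k R)) (Coalgebra.comul (R := k) r) := by
  -- The character is `χ = ε ∘ σ`.
  refine ⟨(Bialgebra.counitAlgHom k R).comp σ.toAlgHom, fun r => ?_⟩
  have h1 := h.rTensor B
  set l := Algebra.TensorProduct.map j (AlgHom.id k B) with hl
  set m := Algebra.TensorProduct.map (AlgHom.id k R) j with hm
  have hlm : ∀ w, Algebra.TensorProduct.map j j w = l (m w) := by
    intro w
    have : Algebra.TensorProduct.map j j = l.comp m := by ext <;> simp [hl, hm]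
    rw [this]
    rfl
  have hx' : Coalgebra.comul (R := k) x = l (m w + 1 ⊗ₜ x) + x ⊗ₜ[k] 1 := by
    rw [hx, hlm, map_add, add_right_comm]
    congr 2
    simp [hl]
  have e := congrArg (Bialgebra.comulAlgHom k B) (h.comm r)
  simp only [map_mul, map_add, Bialgebra.comulAlgHom_apply, hj, hlm, hx', add_mul, mul_add,
    h1.comm] at e
  -- In `Δ` of the commutation rule, the coefficients of `x ⊗ 1` give `(σ ⊗ id) Δ(r) = Δ(σ(r))`;
  -- applying `ε ⊗ id` then yields the formula.
  have key := h1.add_mul_inj (a := (m w + 1 ⊗ₜ[k] x) * m (Coalgebra.comul (R := k) r) +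
      LinearMap.rTensor B δ (m (Coalgebra.comul (R := k) r)))
    (b := Algebra.TensorProduct.congr σ AlgEquiv.refl (m (Coalgebra.comul (R := k) r)))
    (a' := m (Coalgebra.comul (R := k) (σ r)) * (m w + 1 ⊗ₜ[k] x) +
      m (Coalgebra.comul (R := k) (δ r))) (b' := m (Coalgebra.comul (R := k) (σ r))) (by
      simp only [map_add, map_mul, add_mul, mul_add]
      simp only [← add_assoc] at e ⊢
      convert e using 1 <;> abel)
  have hcomm : ∀ y, Algebra.TensorProduct.congr σ AlgEquiv.refl (m y) =
      m (Algebra.TensorProduct.congr σ AlgEquiv.refl y) := by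
    intro y
    induction y with
    | zero => simp
    | add p q hp hq => simp only [map_add, hp, hq]
    | tmul p q => simp [hm]
  have e2 := key.2
  rw [hcomm] at e2
  have e3 := algebraTensorMap_injective (k := k) Function.injective_id h.injective e2
  have e4 := congrArg (counitLeft k R) e3
  rw [counitLeft_comul] at e4
  rw [← e4]
  generalize Coalgebra.comul (R := k) r = y
  induction y with
  | zero => simp
  | add p q hp hq => simp only [map_add, hp, hq]
  | tmul p q => simp [counitLeft_tmul]

end IsOreHom

end MainStep

/-! ### The monomial basis of an Ore extension -/

/-- The exponent obtained from `m` by appending `e`. -/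
noncomputable def expSnoc {i : ℕ} (m : Fin i →₀ ℕ) (e : ℕ) : Fin (i + 1) →₀ ℕ :=
  Finsupp.equivFunOnFinite.symm (Fin.snoc (α := fun _ => ℕ) m e)

/-- The weights obtained from `d` by appending `N`. -/
def weightSnoc {i : ℕ} (d : Fin i → ℕ) (N : ℕ) : Fin (i + 1) → ℕ :=
  Fin.snoc (α := fun _ => ℕ) d N

theorem expSnoc_castSucc {i : ℕ} (m : Fin i →₀ ℕ) (e : ℕ) (l : Fin i) :
    expSnoc m e l.castSucc = m l := by
  simp [expSnoc]

theorem expSnoc_last {i : ℕ} (m : Fin i →₀ ℕ) (e : ℕ) : expSnoc m e (Fin.last i) = e := by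
  simp [expSnoc]

theorem weightSnoc_castSucc {i : ℕ} (d : Fin i → ℕ) (N : ℕ) (l : Fin i) :
    weightSnoc d N l.castSucc = d l := by
  simp [weightSnoc]

theorem weightSnoc_last {i : ℕ} (d : Fin i → ℕ) (N : ℕ) : weightSnoc d N (Fin.last i) = N := by
  simp [weightSnoc]

/-- Splitting off the last entry of an exponent. -/
noncomputable def expSnocEquiv (i : ℕ) : (Σ _ : ℕ, (Fin i →₀ ℕ)) ≃ (Fin (i + 1) →₀ ℕ) where
  toFun p := expSnoc p.2 p.1
  invFun m := ⟨m (Fin.last i), Finsupp.equivFunOnFinite.symm fun l => m l.castSucc⟩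
  left_inv p := by
    obtain ⟨e, m⟩ := p
    simp only [expSnoc_last, expSnoc_castSucc]
    congr 1
    ext l
    simp
  right_inv m := by
    ext l
    refine Fin.lastCases ?_ (fun l => ?_) l
    · rw [expSnoc_last]
    · rw [expSnoc_castSucc]
      simp

theorem exists_eq_expSnoc {i : ℕ} (m : Fin (i + 1) →₀ ℕ) : ∃ p e, m = expSnoc p e :=
  ⟨_, _, ((expSnocEquiv i).apply_symm_apply m).symm⟩

theorem expSnoc_add {i : ℕ} (m m' : Fin i →₀ ℕ) (e e' : ℕ) :
    expSnoc (m + m') (e + e') = expSnoc m e + expSnoc m' e' := by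
  ext l
  refine Fin.lastCases ?_ (fun l => ?_) l
  · simp [expSnoc_last]
  · simp [expSnoc_castSucc]

theorem expSnoc_zero {i : ℕ} : expSnoc (0 : Fin i →₀ ℕ) 0 = 0 := by
  ext l
  refine Fin.lastCases ?_ (fun l => ?_) l
  · simp [expSnoc_last]
  · simp [expSnoc_castSucc]

theorem weight_expSnoc {i : ℕ} (d : Fin i → ℕ) (N : ℕ) (m : Fin i →₀ ℕ) (e : ℕ) :
    Finsupp.weight (weightSnoc d N) (expSnoc m e) = Finsupp.weight d m + e * N := by
  rw [Finsupp.weight_eq_sum, Finsupp.weight_eq_sum, Fin.sum_univ_castSucc]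
  simp [expSnoc_last, expSnoc_castSucc, weightSnoc_last, weightSnoc_castSucc]

section OrePBW

variable {k : Type*} [Field k] {R B : Type*} [Ring R] [Algebra k R] [Ring B] [Algebra k B]
  {j : R →ₐ[k] B} {x : B} {σ : R ≃ₐ[k] R} {δ : R →ₗ[k] R} {i : ℕ}

namespace IsOreHom

/-- The basis of an Ore extension given by a basis of the coefficient algebra and the powers of
the variable. -/
noncomputable def pbwBasis (h : IsOreHom j x σ δ) (b : Module.Basis (Fin i →₀ ℕ) k R) :
    Module.Basis (Fin (i + 1) →₀ ℕ) k B :=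
  ((Finsupp.basis fun _ : ℕ => b).map h.coeff.symm).reindex (expSnocEquiv i)

theorem pbwBasis_expSnoc (h : IsOreHom j x σ δ) (b : Module.Basis (Fin i →₀ ℕ) k R)
    (m : Fin i →₀ ℕ) (e : ℕ) : h.pbwBasis b (expSnoc m e) = j (b m) * x ^ e := by
  have : (expSnocEquiv i).symm (expSnoc m e) = ⟨e, m⟩ := (expSnocEquiv i).symm_apply_apply ⟨e, m⟩
  rw [pbwBasis, Module.Basis.reindex_apply, this, Module.Basis.map_apply, Finsupp.coe_basis,
    LinearEquiv.symm_apply_eq, coeff_mul_pow]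

/-- Computing `x a c` in two ways and comparing coefficients yields the Leibniz rule, so it need not
be part of `IsOreHom` nor be checked after tensoring. -/
theorem leibniz (h : IsOreHom j x σ δ) (a c : R) : δ (a * c) = σ a * δ c + δ a * c := by
  have e := h.comm (a * c)
  rw [map_mul, ← mul_assoc, h.comm, add_mul, mul_assoc, h.comm, mul_add] at e
  have e' : j (σ a * δ c + δ a * c) + j (σ a * σ c) * x = j (δ (a * c)) + j (σ (a * c)) * x := by
    rw [add_comm (j (δ (a * c))), ← e]
    simp only [map_add, map_mul, mul_assoc]
    abel
  exact (h.add_mul_inj e').1.symm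

theorem delta_one (h : IsOreHom j x σ δ) : δ 1 = 0 := by
  have := h.leibniz 1 1
  simpa using this

variable {b : Module.Basis (Fin i →₀ ℕ) k R} {d : Fin i → ℕ} {N : ℕ}

/-- The two bounds pass from generators to products by `σ(ac) - ac = σ(a)(σ(c) - c) + (σ(a) - a)c`
and the twisted Leibniz rule. -/
theorem twist_mem_pbwLT (h : IsOreHom j x σ δ) (hb : IsPBWDeformation b d) (hd : ∀ l, 0 < d l)
    (hσ : ∀ l, σ (b (Finsupp.single l 1)) - b (Finsupp.single l 1) ∈ pbwLT b d (d l))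
    (hδ : ∀ l, δ (b (Finsupp.single l 1)) ∈ pbwLT b d (d l + N)) (r : ℕ) {a : R}
    (ha : a ∈ pbwLT b d (r + 1)) : σ a - a ∈ pbwLT b d r ∧ δ a ∈ pbwLT b d (r + N) := by
  let S : ℕ → Submodule k R := fun r => pbwLT b d (r + 1) ⊓
    ((pbwLT b d r).comap (σ.toLinearMap - LinearMap.id) ⊓ (pbwLT b d (r + N)).comap δ)
  have hS : ∀ r a, a ∈ S r ↔ a ∈ pbwLT b d (r + 1) ∧ σ a - a ∈ pbwLT b d r ∧
      δ a ∈ pbwLT b d (r + N) := fun r a => Iff.rfl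
  have key := hb.pbwLT_le_of_generators hd S ?_ ?_ ?_ ?_ r ha
  · exact ((hS r a).1 key).2
  · intro r s hrs a ha
    rw [hS] at ha ⊢
    exact ⟨pbwLT_mono (by omega) ha.1, pbwLT_mono hrs ha.2.1, pbwLT_mono (by omega) ha.2.2⟩
  · rw [hS, map_one, sub_self, h.delta_one]
    exact ⟨hb.one_mem, zero_mem _, zero_mem _⟩
  · intro l
    rw [hS]
    exact ⟨generator_mem_pbwLT l, hσ l, hδ l⟩
  · intro r s a c ha hc
    rw [hS] at ha hc ⊢
    have hσa : σ a ∈ pbwLT b d (r + 1) := by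
      simpa using add_mem (pbwLT_mono (Nat.le_succ r) ha.2.1) ha.1
    refine ⟨hb.mul_mem ha.1 hc.1, ?_, ?_⟩
    · have e : σ (a * c) - a * c = σ a * (σ c - c) + (σ a - a) * c := by
        rw [map_mul]
        noncomm_ring
      rw [e]
      exact add_mem (hb.mul_mem_right hσa hc.2.1) (hb.mul_mem_left ha.2.1 hc.1)
    · rw [h.leibniz]
      refine add_mem ?_ ?_
      · rw [add_assoc]
        exact hb.mul_mem_right hσa hc.2.2
      · rw [add_right_comm]
        exact hb.mul_mem_left ha.2.2 hc.1

theorem map_mul_pow_mem_pbwLT (h : IsOreHom j x σ δ) {r t e : ℕ} {a : R} (ha : a ∈ pbwLT b d r)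
    (ht : r + e * N ≤ t) : j a * x ^ e ∈ pbwLT (h.pbwBasis b) (weightSnoc d N) t := by
  have : pbwLT b d r ≤ (pbwLT (h.pbwBasis b) (weightSnoc d N) t).comap
      (LinearMap.mulRight k (x ^ e) ∘ₗ j.toLinearMap) := by
    refine pbwLT_le fun m hm => ?_
    simp only [Submodule.mem_comap, LinearMap.comp_apply, AlgHom.toLinearMap_apply,
      LinearMap.mulRight_apply]
    rw [← h.pbwBasis_expSnoc]
    exact basis_mem_pbwLT (by rw [weight_expSnoc]; omega)
  exact this ha

theorem pbwLT_pbwBasis_le (h : IsOreHom j x σ δ) {r : ℕ} {S : Submodule k B}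
    (hS : ∀ m e, Finsupp.weight d m + e * N < r → j (b m) * x ^ e ∈ S) :
    pbwLT (h.pbwBasis b) (weightSnoc d N) r ≤ S := by
  refine pbwLT_le fun m hm => ?_
  obtain ⟨m, e, rfl⟩ := exists_eq_expSnoc m
  rw [weight_expSnoc] at hm
  rw [h.pbwBasis_expSnoc]
  exact hS m e hm

/-- Here `x` has weight `N`. From `x a - a x = (σ(a) - a) x + δ(a)`, the hypotheses say that `x`
commutes with the generators up to lower weight. -/
theorem isPBWDeformation (h : IsOreHom j x σ δ) (hb : IsPBWDeformation b d) (hd : ∀ l, 0 < d l)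
    (hσ : ∀ l, σ (b (Finsupp.single l 1)) - b (Finsupp.single l 1) ∈ pbwLT b d (d l))
    (hδ : ∀ l, δ (b (Finsupp.single l 1)) ∈ pbwLT b d (d l + N)) :
    IsPBWDeformation (h.pbwBasis b) (weightSnoc d N) := by
  set F := pbwLT (h.pbwBasis b) (weightSnoc d N) with hF
  have htw := fun r a ha => h.twist_mem_pbwLT hb hd hσ hδ (N := N) r (a := a) ha
  have hσm : ∀ r a, a ∈ pbwLT b d (r + 1) → σ a ∈ pbwLT b d (r + 1) := by
    intro r a ha
    simpa using add_mem (pbwLT_mono (Nat.le_succ r) (htw r a ha).1) ha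
  have hx : ∀ s y, y ∈ F s → x * y ∈ F (s + N) := by
    intro s y hy
    have : F s ≤ (F (s + N)).comap (LinearMap.mulLeft k x) := by
      refine h.pbwLT_pbwBasis_le fun m e hm => ?_
      have hbm : b m ∈ pbwLT b d (Finsupp.weight d m + 1) := basis_mem_pbwLT (Nat.lt_succ_self _)
      simp only [Submodule.mem_comap, LinearMap.mulLeft_apply]
      rw [← mul_assoc, h.comm, add_mul, mul_assoc, ← pow_succ']
      refine add_mem (h.map_mul_pow_mem_pbwLT (hσm _ _ hbm) ?_)
        (h.map_mul_pow_mem_pbwLT (htw _ _ hbm).2 ?_)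
      · rw [Nat.succ_mul]; omega
      · omega
    exact this hy
  have hxr : ∀ s f y, y ∈ F s → y * x ^ f ∈ F (s + f * N) := by
    intro s f y hy
    have : F s ≤ (F (s + f * N)).comap (LinearMap.mulRight k (x ^ f)) := by
      refine h.pbwLT_pbwBasis_le fun m e hm => ?_
      simp only [Submodule.mem_comap, LinearMap.mulRight_apply]
      rw [mul_assoc, ← pow_add]
      exact h.map_mul_pow_mem_pbwLT (basis_mem_pbwLT (d := d) (Nat.lt_succ_self _))
        (by rw [Nat.add_mul]; omega)
    exact this hy
  have hl : ∀ r s a y, a ∈ pbwLT b d (r + 1) → y ∈ F s → j a * y ∈ F (r + s) := by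
    intro r s a y ha hy
    have : F s ≤ (F (r + s)).comap (LinearMap.mulLeft k (j a)) := by
      refine h.pbwLT_pbwBasis_le fun m e hm => ?_
      simp only [Submodule.mem_comap, LinearMap.mulLeft_apply]
      rw [← mul_assoc, ← map_mul]
      exact h.map_mul_pow_mem_pbwLT
        (hb.mul_mem ha (basis_mem_pbwLT (d := d) (Nat.lt_succ_self _))) (by omega)
    exact this hy
  -- Commuting `x ^ e` past `a` is all that is needed to reorder a product of two ordered monomials.
  have hcomm : ∀ r a, a ∈ pbwLT b d (r + 1) → ∀ e : ℕ,
      x ^ e * j a - j a * x ^ e ∈ F (r + e * N) := by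
    intro r a ha e
    induction e with
    | zero => simp
    | succ e ih =>
      have e1 : x ^ (e + 1) * j a - j a * x ^ (e + 1) =
          x * (x ^ e * j a - j a * x ^ e) + (j (σ a - a) * x ^ (e + 1) + j (δ a) * x ^ e) := by
        have : x * (j a * x ^ e) = j (σ a) * x ^ (e + 1) + j (δ a) * x ^ e := by
          rw [← mul_assoc, h.comm, add_mul, mul_assoc, ← pow_succ']
        rw [mul_sub, this, ← mul_assoc, ← pow_succ', map_sub, sub_mul]
        abel
      rw [e1]
      have hN : r + (e + 1) * N = r + e * N + N := by ring
      rw [hN]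
      exact add_mem (hx _ _ ih) (add_mem
        (h.map_mul_pow_mem_pbwLT (htw r a ha).1 (by rw [← hN]))
        (h.map_mul_pow_mem_pbwLT (htw r a ha).2 (by omega)))
  refine ⟨?_, fun m n => ?_⟩
  · rw [← expSnoc_zero, h.pbwBasis_expSnoc, hb.one]
    simp
  · obtain ⟨m, e, rfl⟩ := exists_eq_expSnoc m
    obtain ⟨n, f, rfl⟩ := exists_eq_expSnoc n
    have hbm : b m ∈ pbwLT b d (Finsupp.weight d m + 1) := basis_mem_pbwLT (Nat.lt_succ_self _)
    have hbn : b n ∈ pbwLT b d (Finsupp.weight d n + 1) := basis_mem_pbwLT (Nat.lt_succ_self _)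
    rw [← expSnoc_add]
    simp only [h.pbwBasis_expSnoc, weight_expSnoc]
    have e1 : j (b m) * x ^ e * (j (b n) * x ^ f) - j (b (m + n)) * x ^ (e + f) =
        j (b m) * (x ^ e * j (b n) - j (b n) * x ^ e) * x ^ f +
          j (b m * b n - b (m + n)) * x ^ (e + f) := by
      rw [pow_add, map_sub, map_mul]
      noncomm_ring
    rw [e1]
    refine add_mem (pbwLT_mono ?_ (hxr _ f _ (hl _ _ _ _ hbm (hcomm _ _ hbn e))))
      (h.map_mul_pow_mem_pbwLT (hb.mul m n) ?_)
    · omega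
    · rw [Nat.add_mul]; omega

end IsOreHom

end OrePBW

/-! ### Hopf subalgebras as bialgebras -/

section HopfSubalgebra

variable {k : Type u} {H : Type v} [Field k] [Ring H] [HopfAlgebra k H]

theorem tensorVal_injective (A : Subalgebra k H) :
    Function.Injective (Algebra.TensorProduct.map A.val A.val) :=
  algebraTensorMap_injective Subtype.val_injective Subtype.val_injective

/-- The comultiplication of a Hopf subalgebra. -/
noncomputable def IsHopfSubalgebra.comulHom {A : Subalgebra k H} (hA : IsHopfSubalgebra A) :
    A →ₐ[k] A ⊗[k] A :=
  (AlgEquiv.ofInjective (Algebra.TensorProduct.map A.val A.val)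
    (tensorVal_injective A)).symm.toAlgHom.comp
    (((Bialgebra.comulAlgHom k H).comp A.val).codRestrict
      (Algebra.TensorProduct.map A.val A.val).range fun a => hA.comul_mem a a.2)

theorem IsHopfSubalgebra.map_comulHom {A : Subalgebra k H} (hA : IsHopfSubalgebra A) (a : A) :
    Algebra.TensorProduct.map A.val A.val (hA.comulHom a) = Coalgebra.comul (R := k) (a : H) := by
  have := congrArg Subtype.val (AlgEquiv.apply_symm_apply
    (AlgEquiv.ofInjective (Algebra.TensorProduct.map A.val A.val) (tensorVal_injective A))
    ((((Bialgebra.comulAlgHom k H).comp A.val).codRestrict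
      (Algebra.TensorProduct.map A.val A.val).range fun a => hA.comul_mem a a.2) a))
  exact this

/-- A Hopf subalgebra is a bialgebra. -/
noncomputable abbrev IsHopfSubalgebra.bialgebra {A : Subalgebra k H} (hA : IsHopfSubalgebra A) :
    Bialgebra k A :=
  Bialgebra.ofAlgHom hA.comulHom ((Bialgebra.counitAlgHom k H).comp A.val)
    (by
      -- Over a field `A ⊗ (A ⊗ A)` embeds in `H ⊗ (H ⊗ H)`, where coassociativity is known.
      have hinj : Function.Injective
          (Algebra.TensorProduct.map A.val (Algebra.TensorProduct.map A.val A.val)) :=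
        algebraTensorMap_injective Subtype.val_injective (tensorVal_injective A)
      refine AlgHom.ext fun a => hinj ?_
      have h1 : ∀ w, Algebra.TensorProduct.map A.val (Algebra.TensorProduct.map A.val A.val)
          (((Algebra.TensorProduct.assoc k k k A A A).toAlgHom.comp
            (Algebra.TensorProduct.map hA.comulHom (.id k A))) w) =
          comulLeft k H (Algebra.TensorProduct.map A.val A.val w) := by
        intro w
        induction w with
        | zero => simp
        | add p q hp hq => simp_all
        | tmul p q =>
          simp only [comulLeft, AlgHom.comp_apply, Algebra.TensorProduct.map_tmul,
            Bialgebra.comulAlgHom_apply, AlgHom.id_apply, Subalgebra.coe_val,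
            ← hA.map_comulHom]
          generalize hA.comulHom p = w
          induction w with
          | zero => simp
          | tmul p q => simp
          | add p q hp hq => simp_all [TensorProduct.add_tmul]
      have h2 : ∀ w, Algebra.TensorProduct.map A.val (Algebra.TensorProduct.map A.val A.val)
          (Algebra.TensorProduct.map (.id k A) hA.comulHom w) =
          comulRight k H (Algebra.TensorProduct.map A.val A.val w) := by
        intro w
        induction w with
        | zero => simp
        | add p q hp hq => simp_all
        | tmul p q => simp [comulRight, hA.map_comulHom]
      have h3 := h1 (hA.comulHom a)
      have h4 := h2 (hA.comulHom a)
      rw [hA.map_comulHom] at h3 h4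
      exact h3.trans ((comulLeft_comul k (a : H)).trans h4.symm))
    (by
      refine AlgHom.ext fun a => (Algebra.TensorProduct.lid k A).injective
        (Subtype.val_injective ?_)
      have h1 : ∀ w, ((Algebra.TensorProduct.lid k A (Algebra.TensorProduct.map
          ((Bialgebra.counitAlgHom k H).comp A.val) (.id k A) w) : A) : H) =
          counitLeft k H (Algebra.TensorProduct.map A.val A.val w) := by
        intro w
        induction w with
        | zero => simp
        | add p q hp hq => simp_all
        | tmul p q => simp [counitLeft_tmul]
      have h2 := h1 (hA.comulHom a)
      rw [hA.map_comulHom, counitLeft_comul] at h2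
      refine h2.trans ?_
      simp)
    (by
      refine AlgHom.ext fun a => (Algebra.TensorProduct.rid k k A).injective
        (Subtype.val_injective ?_)
      have h1 : ∀ w, ((Algebra.TensorProduct.rid k k A (Algebra.TensorProduct.map
          (.id k A) ((Bialgebra.counitAlgHom k H).comp A.val) w) : A) : H) =
          counitRight k H (Algebra.TensorProduct.map A.val A.val w) := by
        intro w
        induction w with
        | zero => simp
        | add p q hp hq => simp_all
        | tmul p q => simp [counitRight_tmul]
      have h2 := h1 (hA.comulHom a)
      rw [hA.map_comulHom, counitRight_comul] at h2
      refine h2.trans ?_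
      simp)

/-- For group-like `y`, the antipode gives `S(y) y = ε(y)`, and `y = ε(y) y` shows `ε(y) ≠ 0`. This
is the only use of the antipode. -/
theorem IsHopfSubalgebra.exists_left_inverse {A : Subalgebra k H} (hA : IsHopfSubalgebra A)
    (y : A) (hy : y ≠ 0) (h : hA.comulHom y = y ⊗ₜ[k] y) : ∃ z, z * y = 1 := by
  have h1 : Coalgebra.comul (R := k) (y : H) = (y : H) ⊗ₜ[k] (y : H) := by
    rw [← hA.map_comulHom, h]
    simp
  have h2 := counitLeft_comul (k := k) (y : H)
  rw [h1, counitLeft_tmul] at h2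
  have hε : Coalgebra.counit (R := k) (y : H) ≠ 0 := by
    intro h0
    rw [h0, zero_smul] at h2
    exact hy (Subtype.ext h2.symm)
  have h3 := HopfAlgebra.mul_antipode_rTensor_comul_apply (R := k) (y : H)
  rw [h1, LinearMap.rTensor_tmul, LinearMap.mul'_apply, Algebra.algebraMap_eq_smul_one] at h3
  refine ⟨(Coalgebra.counit (R := k) (y : H))⁻¹ • ⟨_, hA.antipode_mem y y.2⟩, Subtype.ext ?_⟩
  simp [h3, smul_smul, hε]

end HopfSubalgebra

/-! ### Ordered monomials -/

section Monomials

variable {H : Type v} [Ring H]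

theorem pbwMonomial_expSnoc {i : ℕ} (X : Fin (i + 1) → H) (m : Fin i →₀ ℕ) (e : ℕ) :
    pbwMonomial X (expSnoc m e) = pbwMonomial (fun l => X l.castSucc) m * X (Fin.last i) ^ e := by
  simp only [pbwMonomial, List.ofFn_succ', List.concat_eq_append, List.prod_append,
    expSnoc_castSucc, expSnoc_last, List.prod_singleton]

theorem pbwMonomial_zero {i : ℕ} (X : Fin i → H) : pbwMonomial X 0 = 1 := by
  simp [pbwMonomial]

theorem pbwMonomial_single {i : ℕ} (X : Fin i → H) (l : Fin i) :
    pbwMonomial X (Finsupp.single l 1) = X l := by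
  induction i with
  | zero => exact l.elim0
  | succ i ih =>
    classical
    refine Fin.lastCases ?_ (fun l => ?_) l
    · have : Finsupp.single (Fin.last i) 1 = expSnoc (0 : Fin i →₀ ℕ) 1 := by
        ext l
        refine Fin.lastCases ?_ (fun l => ?_) l
        · simp [expSnoc_last]
        · simp [expSnoc_castSucc]
      rw [this, pbwMonomial_expSnoc, pbwMonomial_zero, one_mul, pow_one]
    · have : Finsupp.single l.castSucc 1 = expSnoc (Finsupp.single l 1) 0 := by
        ext m
        refine Fin.lastCases ?_ (fun m => ?_) m
        · simp [expSnoc_last, (Fin.castSucc_lt_last l).ne]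
        · simp [expSnoc_castSucc, Finsupp.single_apply]
      rw [this, pbwMonomial_expSnoc, ih, pow_zero, mul_one]

end Monomials

/-! ### The data carried through the induction on the number of variables. -/

section Steps

variable {k : Type u} {H : Type v} [Field k] [Ring H] [HopfAlgebra k H] {n : ℕ} {X : Fin n → H}

theorem stepSubalgebra_mono {i i' : ℕ} (h : i ≤ i') :
    stepSubalgebra k X i ≤ stepSubalgebra k X i' :=
  Algebra.adjoin_mono (Set.image_mono fun _ hl => lt_of_lt_of_le hl h)

theorem IsOreExtension.isOreHom {R B : Subalgebra k H} {x : H} {σ : R ≃ₐ[k] R} {δ : R →ₗ[k] R}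
    (h : IsOreExtension R B x σ δ) : IsOreHom (Subalgebra.inclusion h.le) ⟨x, h.mem⟩ σ δ where
  comm r := Subtype.ext (h.commutation r)
  bij := by
    have key : ∀ p, ((oreSum (Subalgebra.inclusion h.le) ⟨x, h.mem⟩ p : B) : H) =
        p.sum fun i r => (r : H) * x ^ i := by
      intro p
      rw [oreSum_apply, Finsupp.sum, Finsupp.sum, AddSubmonoidClass.coe_finsetSum]
      rfl
    constructor
    · intro p q hpq
      obtain ⟨_, -, hu⟩ := h.free _ (oreSum (Subalgebra.inclusion h.le) ⟨x, h.mem⟩ p).2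
      rw [hu p (key p), hu q (by rw [hpq, key])]
    · intro y
      obtain ⟨p, hp, -⟩ := h.free y y.2
      exact ⟨p, Subtype.ext ((key p).trans hp.symm)⟩

variable (k X) in
/-- The variable `X l` is primitive modulo the tensor square of the subalgebra generated by the
preceding variables. -/
def IsPrimitiveStep (l : Fin n) : Prop :=
  ∃ w : stepSubalgebra k X l ⊗[k] stepSubalgebra k X l, Coalgebra.comul (R := k) (X l) =
    Algebra.TensorProduct.map (stepSubalgebra k X l).val (stepSubalgebra k X l).val w +
      X l ⊗ₜ[k] 1 + 1 ⊗ₜ[k] X l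

/-- For every choice of finite subsets `E l` of the algebras generated by the first `l` variables
there are weights for which `b` is multiplicative up to lower terms, and such that the elements
of `E l` have less than half the weight of the `l`-th variable. -/
def HasWeights {i : ℕ} (b : Module.Basis (Fin i →₀ ℕ) k (stepSubalgebra k X i)) : Prop :=
  ∀ E : ℕ → Finset H, (∀ l, ∀ e ∈ E l, e ∈ stepSubalgebra k X l) →
    ∃ d : Fin i → ℕ, (∀ l, 0 < d l) ∧ IsPBWDeformation b d ∧
      ∀ l : Fin i, ∀ e ∈ E l, ∃ s, 2 * s < d l ∧
        ∃ a : stepSubalgebra k X i, (a : H) = e ∧ a ∈ pbwLT b d (s + 1)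

/-- Only the finitely many tensor factors in `E` need small weight. They are recorded in `H` so that
the same sets can be used at every later step. -/
theorem exists_finset_primitive {l : Fin n} (h : IsPrimitiveStep k X l) :
    ∃ (E : Finset H) (S : Finset (H × H)), (∀ e ∈ E, e ∈ stepSubalgebra k X l) ∧
      (∀ p ∈ S, p.1 ∈ E ∧ p.2 ∈ E) ∧
      Coalgebra.comul (R := k) (X l) = ∑ p ∈ S, p.1 ⊗ₜ[k] p.2 + X l ⊗ₜ[k] 1 + 1 ⊗ₜ[k] X l := by
  classical
  obtain ⟨w, hw⟩ := h
  obtain ⟨S, rfl⟩ := TensorProduct.exists_finset w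
  let S' : Finset (H × H) := S.map ⟨Prod.map Subtype.val Subtype.val,
    Function.Injective.prodMap Subtype.val_injective Subtype.val_injective⟩
  refine ⟨S'.image Prod.fst ∪ S'.image Prod.snd, S', ?_, ?_, ?_⟩
  · intro e he
    rcases Finset.mem_union.1 he with he | he
    · obtain ⟨p, hp, rfl⟩ := Finset.mem_image.1 he
      obtain ⟨q, -, rfl⟩ := Finset.mem_map.1 hp
      exact q.1.2
    · obtain ⟨p, hp, rfl⟩ := Finset.mem_image.1 he
      obtain ⟨q, -, rfl⟩ := Finset.mem_map.1 hp
      exact q.2.2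
  · intro p hp
    exact ⟨Finset.mem_union_left _ (Finset.mem_image_of_mem _ hp),
      Finset.mem_union_right _ (Finset.mem_image_of_mem _ hp)⟩
  · rw [hw, Finset.sum_map, map_sum]
    rfl

end Steps

/-! ### The Hopf-theoretic step, expressed inside the ambient Hopf algebra. -/

section AbstractStep

variable {k : Type*} [Field k] {R B H : Type*} [Ring R] [Bialgebra k R] [Ring B] [Bialgebra k B]
  [Ring H] [Bialgebra k H] {f : R →ₐ[k] H} {g : B →ₐ[k] H} {j : R →ₐ[k] B} {x : B}
  {σ : R ≃ₐ[k] R} {δ : R →ₗ[k] R}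

theorem isPrimitiveMod_of_sum {ι : Type*} {b : Module.Basis (ι →₀ ℕ) k R} {d : ι → ℕ}
    (hf : Function.Injective f)
    (hfc : ∀ a, Algebra.TensorProduct.map f f (Coalgebra.comul (R := k) a) =
      Coalgebra.comul (R := k) (f a))
    (S : ι → Finset (H × H))
    (hS : ∀ l, Coalgebra.comul (R := k) (f (b (Finsupp.single l 1))) = ∑ p ∈ S l, p.1 ⊗ₜ[k] p.2 +
      f (b (Finsupp.single l 1)) ⊗ₜ[k] 1 + 1 ⊗ₜ[k] f (b (Finsupp.single l 1)))
    (hSd : ∀ l, ∀ p ∈ S l, (∃ s, 2 * s < d l ∧ ∃ a, f a = p.1 ∧ a ∈ pbwLT b d (s + 1)) ∧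
      ∃ s, 2 * s < d l ∧ ∃ a, f a = p.2 ∧ a ∈ pbwLT b d (s + 1)) : IsPrimitiveMod b d := by
  intro l
  have h1 : ∑ p ∈ S l, p.1 ⊗ₜ[k] p.2 ∈ (pbwLT (pbwTensor b b) (Sum.elim d d) (d l)).map
      (Algebra.TensorProduct.map f f).toLinearMap := by
    refine sum_mem fun p hp => ?_
    obtain ⟨⟨s, hs, a, ha, has⟩, ⟨s', hs', a', ha', has'⟩⟩ := hSd l p hp
    -- Each factor weighs less than half of `d l`, so their tensor product weighs less than `d l`.
    refine ⟨a ⊗ₜ a', tmul_mem_pbwLT has has' (by omega), ?_⟩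
    rw [← ha, ← ha']
    rfl
  obtain ⟨y, hy, hyS⟩ := h1
  suffices e : Coalgebra.comul (R := k) (b (Finsupp.single l 1)) -
      (b (Finsupp.single l 1) ⊗ₜ[k] 1 + 1 ⊗ₜ[k] b (Finsupp.single l 1)) = y by rwa [e]
  refine algebraTensorMap_injective hf hf ?_
  rw [map_sub, hfc]
  refine Eq.trans ?_ hyS.symm
  rw [sub_eq_iff_eq_add, map_add, ← add_assoc, hS]
  simp

/-- If `Δ(r) = w + r ⊗ 1 + 1 ⊗ r` with `w ∈ A ⊗ A`, the winding formula gives `σ(r) - r = (χ ⊗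
id)(w) + χ(r)`, an element of `A`. -/
theorem IsOreHom.comul_and_winding (h : IsOreHom j x σ δ) (hf : Function.Injective f)
    (hg : Function.Injective g) (hgj : ∀ r, g (j r) = f r)
    (hfc : ∀ a, Algebra.TensorProduct.map f f (Coalgebra.comul (R := k) a) =
      Coalgebra.comul (R := k) (f a))
    (hgc : ∀ a, Algebra.TensorProduct.map g g (Coalgebra.comul (R := k) a) =
      Coalgebra.comul (R := k) (g a))
    (hε : ∀ r, Coalgebra.counit (R := k) (j r) = Coalgebra.counit (R := k) r)
    (hgl : ∀ y : B, y ≠ 0 → Coalgebra.comul (R := k) y = y ⊗ₜ[k] y → ∃ z, z * y = 1)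
    [Nontrivial R] {ι : Type*} {b : Module.Basis (ι →₀ ℕ) k R} {d : ι → ℕ}
    (hb : IsPBWDeformation b d) (hd : ∀ i, 0 < d i) (hp : IsPrimitiveMod b d) :
    (∃ w : R ⊗[k] R, Coalgebra.comul (R := k) (g x) = Algebra.TensorProduct.map f f w +
      g x ⊗ₜ[k] 1 + 1 ⊗ₜ[k] g x) ∧
    ∀ (A : Subalgebra k H) (r : R) (w : A ⊗[k] A), Coalgebra.comul (R := k) (f r) =
      Algebra.TensorProduct.map A.val A.val w + f r ⊗ₜ[k] 1 + 1 ⊗ₜ[k] f r →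
      (∀ a : A, ∃ r, f r = a) → f (σ r) - f r ∈ A := by
  have hval : ∀ w, Algebra.TensorProduct.map g g (Algebra.TensorProduct.map j j w) =
      Algebra.TensorProduct.map f f w := by
    intro w
    induction w with
    | zero => simp
    | add p q hp hq => simp only [map_add, hp, hq]
    | tmul p q => simp [hgj]
  have hj : ∀ r, Coalgebra.comul (R := k) (j r) =
      Algebra.TensorProduct.map j j (Coalgebra.comul (R := k) r) := by
    intro r
    refine algebraTensorMap_injective hg hg ?_
    rw [hgc, hval, hfc, hgj]
  obtain ⟨w, hx⟩ := h.comul_variable hj hε hgl hb hd hp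
  obtain ⟨χ, hχ⟩ := h.exists_winding hj hx
  refine ⟨⟨w, ?_⟩, fun A r y hr hA => ?_⟩
  · rw [← hgc, hx, map_add, map_add, hval]
    simp
  · have key : ∀ y : A ⊗[k] A, ∃ y' : R ⊗[k] R, Algebra.TensorProduct.map f f y' =
        Algebra.TensorProduct.map A.val A.val y ∧
        f ((Algebra.TensorProduct.lid k R).toAlgHom.comp
          (Algebra.TensorProduct.map χ (AlgHom.id k R)) y') ∈ A := by
      intro y
      induction y with
      | zero => exact ⟨0, by simp, by simp⟩
      | add p q hp hq =>
        obtain ⟨p', hp1, hp2⟩ := hp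
        obtain ⟨q', hq1, hq2⟩ := hq
        refine ⟨p' + q', by rw [map_add, map_add, hp1, hq1], ?_⟩
        rw [map_add, map_add]
        exact add_mem hp2 hq2
      | tmul p q =>
        obtain ⟨p', hp'⟩ := hA p
        obtain ⟨q', hq'⟩ := hA q
        refine ⟨p' ⊗ₜ q', by simp [hp', hq'], ?_⟩
        have : f ((Algebra.TensorProduct.lid k R).toAlgHom.comp
          (Algebra.TensorProduct.map χ (AlgHom.id k R)) (p' ⊗ₜ[k] q')) = χ p' • (q : H) := by
          simp [hq']
        rw [this]
        exact A.smul_mem q.2 _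
    obtain ⟨y', hy1, hy2⟩ := key y
    have hr' : Coalgebra.comul (R := k) r = y' + r ⊗ₜ[k] 1 + 1 ⊗ₜ[k] r := by
      refine algebraTensorMap_injective hf hf ?_
      rw [hfc, hr, map_add, map_add, hy1]
      simp
    have e : f (σ r) - f r = f ((Algebra.TensorProduct.lid k R).toAlgHom.comp
          (Algebra.TensorProduct.map χ (AlgHom.id k R)) y') + χ r • 1 := by
      rw [hχ r, hr', map_add, map_add, map_add, map_add]
      simp
    rw [e]
    exact add_mem hy2 (A.smul_mem A.one_mem _)

end AbstractStep

theorem nontrivial_of_hopfAlgebra (k H : Type*) [Field k] [Ring H] [HopfAlgebra k H] :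
    Nontrivial H := by
  refine ⟨⟨0, 1, fun h01 => zero_ne_one (α := k) ?_⟩⟩
  rw [← map_zero (Coalgebra.counit (R := k) (A := H)), h01, Bialgebra.counit_one]

/-! ### The induction over the steps of the iterated extension. -/

section Induction

variable {k : Type u} {H : Type v} [Field k] [Ring H] [HopfAlgebra k H] {n : ℕ} {X : Fin n → H}

/-- The bialgebra structures on `A` and `C` are local to the proof; the statement uses only the
comultiplication of `H`. -/
theorem IsHopfSubalgebra.comul_and_winding {A C : Subalgebra k H} (hA : IsHopfSubalgebra A)
    (hC : IsHopfSubalgebra C) {x : H} {σ : A ≃ₐ[k] A} {δ : A →ₗ[k] A}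
    (h : IsOreExtension A C x σ δ) {ι : Type*} {b : Module.Basis (ι →₀ ℕ) k A} {d : ι → ℕ}
    (hb : IsPBWDeformation b d) (hd : ∀ i, 0 < d i)
    (S : ι → Finset (H × H))
    (hS : ∀ l, Coalgebra.comul (R := k) (b (Finsupp.single l 1) : H) =
      ∑ p ∈ S l, p.1 ⊗ₜ[k] p.2 +
      (b (Finsupp.single l 1) : H) ⊗ₜ[k] 1 + 1 ⊗ₜ[k] (b (Finsupp.single l 1) : H))
    (hSd : ∀ l, ∀ p ∈ S l, (∃ s, 2 * s < d l ∧ ∃ a : A, (a : H) = p.1 ∧ a ∈ pbwLT b d (s + 1)) ∧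
      ∃ s, 2 * s < d l ∧ ∃ a : A, (a : H) = p.2 ∧ a ∈ pbwLT b d (s + 1)) :
    (∃ w : A ⊗[k] A, Coalgebra.comul (R := k) x = Algebra.TensorProduct.map A.val A.val w +
      x ⊗ₜ[k] 1 + 1 ⊗ₜ[k] x) ∧
    ∀ (D : Subalgebra k H) (r : A) (w : D ⊗[k] D), Coalgebra.comul (R := k) (r : H) =
      Algebra.TensorProduct.map D.val D.val w + (r : H) ⊗ₜ[k] 1 + 1 ⊗ₜ[k] (r : H) →
      D ≤ A → (σ r : H) - r ∈ D := by
  have : Nontrivial H := nontrivial_of_hopfAlgebra k H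
  let _ := hA.bialgebra
  let _ := hC.bialgebra
  have hp : IsPrimitiveMod b d :=
    isPrimitiveMod_of_sum (f := A.val) Subtype.val_injective hA.map_comulHom S hS hSd
  obtain ⟨h1, h2⟩ := h.isOreHom.comul_and_winding (f := A.val) (g := C.val) Subtype.val_injective
    Subtype.val_injective (fun _ => rfl) hA.map_comulHom hC.map_comulHom (fun _ => rfl)
    hC.exists_left_inverse hb hd hp
  exact ⟨h1, fun D r w hr hD => h2 D r w hr fun a => ⟨⟨a, hD a.2⟩, rfl⟩⟩

/-- In an iterated Hopf Ore extension, each new variable is primitive modulo the previous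
steps, and the automorphisms are unipotent on the variables. -/
theorem IsIHOE.primitive_and_unipotent (hX : IsIHOE k X) {i : ℕ} (hi : i < n)
    {b : Module.Basis (Fin i →₀ ℕ) k (stepSubalgebra k X i)}
    (hb : ∀ l : Fin i, (b (Finsupp.single l 1) : H) = X (Fin.castLE hi.le l))
    (hw : HasWeights b) (hprim : ∀ l : Fin n, (l : ℕ) < i → IsPrimitiveStep k X l)
    {σ : stepSubalgebra k X i ≃ₐ[k] stepSubalgebra k X i}
    {δ : stepSubalgebra k X i →ₗ[k] stepSubalgebra k X i}
    (h : IsOreExtension (stepSubalgebra k X i) (stepSubalgebra k X (i + 1)) (X ⟨i, hi⟩) σ δ) :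
    IsPrimitiveStep k X ⟨i, hi⟩ ∧ ∀ l : Fin i,
      (σ (b (Finsupp.single l 1)) : H) - b (Finsupp.single l 1) ∈ stepSubalgebra k X l := by
  have hES : ∀ l : ℕ, ∃ (E : Finset H) (S : Finset (H × H)),
      (∀ e ∈ E, e ∈ stepSubalgebra k X l) ∧ ∀ hl : l < i, (∀ p ∈ S, p.1 ∈ E ∧ p.2 ∈ E) ∧
      Coalgebra.comul (R := k) (X ⟨l, hl.trans hi⟩) = ∑ p ∈ S, p.1 ⊗ₜ[k] p.2 +
        X ⟨l, hl.trans hi⟩ ⊗ₜ[k] 1 + 1 ⊗ₜ[k] X ⟨l, hl.trans hi⟩ := by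
    intro l
    by_cases hl : l < i
    · obtain ⟨E, S, h1, h2, h3⟩ := exists_finset_primitive (hprim ⟨l, hl.trans hi⟩ hl)
      exact ⟨E, S, h1, fun _ => ⟨h2, h3⟩⟩
    · exact ⟨∅, ∅, by simp, fun hl' => absurd hl' hl⟩
  choose E S hE hS using hES
  -- These weights serve only to make the earlier variables primitive up to lower weight; both
  -- conclusions are free of weights.
  obtain ⟨d, hd, hdef, hEd⟩ := hw E hE
  obtain ⟨h1, h2⟩ := (hX.hopf i hi.le).comul_and_winding (hX.hopf (i + 1) hi) h hdef hd
    (fun l => S l) (fun l => by rw [hb]; exact (hS l l.2).2)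
    (fun l p hp => ⟨hEd l _ ((hS l l.2).1 p hp).1, hEd l _ ((hS l l.2).1 p hp).2⟩)
  refine ⟨h1, fun l => ?_⟩
  obtain ⟨w, hw'⟩ := hprim (Fin.castLE hi.le l) l.2
  exact h2 _ _ w (by rw [hb]; exact hw') (stepSubalgebra_mono l.2.le)

theorem exists_bound_mem_pbwLT {A : Type*} [Ring A] [Algebra k A] {ι τ : Type*}
    (b : Module.Basis (ι →₀ ℕ) k A) (d : ι → ℕ) (s : Finset τ) (f : τ → A) :
    ∃ N, ∀ t ∈ s, f t ∈ pbwLT b d (N + 1) := by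
  choose r hr using fun t => exists_mem_pbwLT b d (f t)
  exact ⟨s.sup r, fun t ht => pbwLT_mono (Nat.succ_le_succ (Finset.le_sup ht)) (hr t)⟩

/-- The property of having weights passes to an Ore extension. -/
theorem HasWeights.succ {i : ℕ} {b : Module.Basis (Fin i →₀ ℕ) k (stepSubalgebra k X i)}
    (hw : HasWeights b) {x : H}
    {σ : stepSubalgebra k X i ≃ₐ[k] stepSubalgebra k X i}
    {δ : stepSubalgebra k X i →ₗ[k] stepSubalgebra k X i}
    (h : IsOreExtension (stepSubalgebra k X i) (stepSubalgebra k X (i + 1)) x σ δ)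
    (hσ : ∀ l : Fin i,
      (σ (b (Finsupp.single l 1)) : H) - b (Finsupp.single l 1) ∈ stepSubalgebra k X l) :
    HasWeights (h.isOreHom.pbwBasis b) := by
  classical
  intro E hE
  -- Prescribing `σ(X_l) - X_l` as well forces weights for which `σ` is unipotent.
  let E' : ℕ → Finset H := fun l => if hl : l < i then insert
    ((σ (b (Finsupp.single ⟨l, hl⟩ 1)) : H) - b (Finsupp.single ⟨l, hl⟩ 1)) (E l) else ∅
  have hE' : ∀ l : Fin i, E' l = insert
      ((σ (b (Finsupp.single l 1)) : H) - b (Finsupp.single l 1)) (E l) :=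
    fun l => dif_pos l.2
  obtain ⟨d, hd, hdef, hEd⟩ := hw E' (by
    intro l e he
    by_cases hl : l < i
    · rw [hE' ⟨l, hl⟩, Finset.mem_insert] at he
      rcases he with rfl | he
      · exact hσ ⟨l, hl⟩
      · exact hE l e he
    · simp [E', hl] at he)
  obtain ⟨N₁, hN₁⟩ := exists_bound_mem_pbwLT b d (E i).attach
    fun e => (⟨e, hE i e e.2⟩ : stepSubalgebra k X i)
  obtain ⟨N₂, hN₂⟩ := exists_bound_mem_pbwLT b d Finset.univ
    fun l : Fin i => δ (b (Finsupp.single l 1))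
  -- The weight of the new variable exceeds twice that of the elements of `E i`, and `N > N₂` makes
  -- every `δ(X_l)` lighter than `X_l x`.
  set N := 2 * N₁ + N₂ + 1 with hN
  refine ⟨weightSnoc d N, ?_, ?_, ?_⟩
  · intro l
    refine Fin.lastCases ?_ (fun l => ?_) l
    · rw [weightSnoc_last]
      omega
    · rw [weightSnoc_castSucc]
      exact hd l
  · refine h.isOreHom.isPBWDeformation hdef hd (fun l => ?_) fun l =>
      pbwLT_mono (by omega) (hN₂ l (Finset.mem_univ l))
    obtain ⟨s, hs, a, ha, has⟩ := hEd l _ (by rw [hE']; exact Finset.mem_insert_self _ _)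
    have : σ (b (Finsupp.single l 1)) - b (Finsupp.single l 1) = a := Subtype.ext ha.symm
    rw [this]
    exact pbwLT_mono (by omega) has
  · have hincl : ∀ (s : ℕ) (a : stepSubalgebra k X i), a ∈ pbwLT b d (s + 1) →
        Subalgebra.inclusion h.le a ∈ pbwLT (h.isOreHom.pbwBasis b) (weightSnoc d N) (s + 1) := by
      intro s a ha
      simpa using h.isOreHom.map_mul_pow_mem_pbwLT (N := N) (e := 0) (t := s + 1) ha (by omega)
    intro l
    refine Fin.lastCases (fun e he => ?_) (fun l e he => ?_) l
    · refine ⟨N₁, by rw [weightSnoc_last]; omega, _, ?_, hincl _ _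
        (hN₁ ⟨e, he⟩ (Finset.mem_attach _ _))⟩
      rfl
    · obtain ⟨s, hs, a, ha, has⟩ := hEd l e (by rw [hE']; exact Finset.mem_insert_of_mem he)
      exact ⟨s, by rw [weightSnoc_castSucc]; exact hs, _, ha, hincl _ _ has⟩

theorem stepSubalgebra_zero : stepSubalgebra k X 0 = ⊥ := by
  simp [stepSubalgebra]

/-- The monomial basis of the base field. -/
theorem exists_basis_zero [Nontrivial H] :
    ∃ b : Module.Basis (Fin 0 →₀ ℕ) k (stepSubalgebra k X 0), ∀ m, (b m : H) = 1 := by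
  let e : k ≃ₗ[k] stepSubalgebra k X 0 :=
    ((Subalgebra.equivOfEq _ _ stepSubalgebra_zero).trans (Algebra.botEquiv k H)).symm.toLinearEquiv
  refine ⟨(Module.Basis.singleton (Fin 0 →₀ ℕ) k).map e, fun m => ?_⟩
  rw [Module.Basis.map_apply, Module.Basis.singleton_apply]
  simp [e]

/-- The structure of the steps of an iterated Hopf Ore extension. -/
theorem IsIHOE.exists_basis (hX : IsIHOE k X) (i : ℕ) (hi : i ≤ n) :
    ∃ b : Module.Basis (Fin i →₀ ℕ) k (stepSubalgebra k X i),
      (∀ m, (b m : H) = pbwMonomial (fun l : Fin i => X (Fin.castLE hi l)) m) ∧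
      HasWeights b ∧ ∀ l : Fin n, (l : ℕ) < i → IsPrimitiveStep k X l := by
  have : Nontrivial H := nontrivial_of_hopfAlgebra k H
  induction i with
  | zero =>
    obtain ⟨b, hb⟩ := exists_basis_zero (k := k) (X := X)
    refine ⟨b, fun m => ?_, fun E hE => ⟨fun _ => 1, fun _ => one_pos, ⟨?_, fun m m' => ?_⟩,
      fun l => l.elim0⟩, fun l hl => absurd hl (Nat.not_lt_zero _)⟩
    · rw [hb, Subsingleton.elim m 0, pbwMonomial_zero]
    · exact Subtype.ext (hb 0)
    · have : b m * b m' - b (m + m') = 0 := Subtype.ext (by simp [hb])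
      rw [this]
      exact zero_mem _
  | succ i ih =>
    obtain ⟨b, hb, hw, hprim⟩ := ih (Nat.le_of_succ_le hi)
    obtain ⟨σ, δ, h⟩ := hX.ore ⟨i, hi⟩
    have hgen : ∀ l : Fin i, (b (Finsupp.single l 1) : H) =
        X (Fin.castLE (Nat.le_of_succ_le hi) l) := fun l => by rw [hb, pbwMonomial_single]
    obtain ⟨h1, h2⟩ := hX.primitive_and_unipotent hi hgen hw hprim h
    refine ⟨h.isOreHom.pbwBasis b, fun m => ?_, hw.succ h h2, fun l hl => ?_⟩
    · obtain ⟨m, e, rfl⟩ := exists_eq_expSnoc m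
      rw [h.isOreHom.pbwBasis_expSnoc, pbwMonomial_expSnoc]
      exact congrArg (· * X ⟨i, hi⟩ ^ e) (hb m)
    · rcases Nat.lt_succ_iff_lt_or_eq.1 hl with hl | hl
      · exact hprim l hl
      · obtain rfl : l = ⟨i, hi⟩ := Fin.ext hl
        exact h1

/-- An iterated Hopf Ore extension has a basis of ordered monomials, which is multiplicative up to
terms of lower weight for suitable positive weights. -/
theorem IsIHOE.exists_pbwDeformation (hX : IsIHOE k X) :
    ∃ b : Module.Basis (Fin n →₀ ℕ) k H, (∀ m, b m = pbwMonomial X m) ∧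
      ∃ d : Fin n → ℕ, (∀ l, 0 < d l) ∧ IsPBWDeformation b d := by
  obtain ⟨b, hb, hw, -⟩ := hX.exists_basis n le_rfl
  -- After the last step nothing further has to be dominated.
  obtain ⟨d, hd, hdef, -⟩ := hw (fun _ => ∅) (by simp)
  let e : stepSubalgebra k X n ≃ₐ[k] H :=
    (Subalgebra.equivOfEq _ _ hX.top).trans Subalgebra.topEquiv
  have he : ∀ a, e a = a := fun a => rfl
  refine ⟨b.map e.toLinearEquiv, fun m => ?_, d, hd, ?_, fun m m' => ?_⟩
  · exact hb m
  · exact congrArg Subtype.val hdef.one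
  · have hle : pbwLT b d (Finsupp.weight d m + Finsupp.weight d m') ≤
        (pbwLT (b.map e.toLinearEquiv) d
          (Finsupp.weight d m + Finsupp.weight d m')).comap e.toLinearMap :=
      pbwLT_le fun p hp => by
        have : e.toLinearMap (b p) = b.map e.toLinearEquiv p := rfl
        rw [Submodule.mem_comap, this]
        exact basis_mem_pbwLT hp
    exact hle (hdef.mul m m')

end Induction

/-! ### The associated graded algebra -/

section Graded

variable {k : Type u} [Field k] {H : Type v} [Ring H] [Algebra k H] {n : ℕ}
  {b : Module.Basis (Fin n →₀ ℕ) k H} {d : Fin n → ℕ}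

theorem mem_pbwFiltration {r : ℕ} {α : H} : α ∈ pbwFiltration b d r ↔ α ∈ pbwLT b d (r + 1) := by
  have : α ∈ pbwFiltration b d r ↔ pbwDegree b d α ≤ r := Iff.rfl
  rw [this, pbwDegree, Finset.sup_le_iff, mem_pbwLT]
  simp only [Finsupp.weight_eq_sum, smul_eq_mul, Nat.lt_succ_iff]

theorem filtrationLT_pbwFiltration (b : Module.Basis (Fin n →₀ ℕ) k H) (d : Fin n → ℕ) (r : ℕ) :
    filtrationLT (pbwFiltration b d) r = pbwLT b d r := by
  refine le_antisymm (iSup₂_le fun s hs α hα => ?_) ?_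
  · exact pbwLT_mono hs (mem_pbwFiltration.1 hα)
  · rcases r with _ | r
    · rw [pbwLT_zero]
      exact bot_le
    · intro α hα
      exact (le_iSup₂ (f := fun s (_ : s < r + 1) => pbwFiltration b d s) r (Nat.lt_succ_self r))
        (mem_pbwFiltration.2 hα)

theorem IsPBWDeformation.isRingFiltration (h : IsPBWDeformation b d) :
    IsRingFiltration (pbwFiltration b d) (filtrationLT (pbwFiltration b d)) where
  mono _ _ hrs α hα :=
    mem_pbwFiltration.2 (pbwLT_mono (Nat.succ_le_succ hrs) (mem_pbwFiltration.1 hα))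
  is_le hrs α hα := by
    rw [filtrationLT_pbwFiltration]
    exact pbwLT_mono hrs (mem_pbwFiltration.1 hα)
  is_sup _ _ hB := iSup₂_le hB
  one_mem := mem_pbwFiltration.2 h.one_mem
  mul_mem _ _ _ _ hα hβ :=
    mem_pbwFiltration.2 (h.mul_mem (mem_pbwFiltration.1 hα) (mem_pbwFiltration.1 hβ))

theorem comap_filtrationLT_le_ker (b : Module.Basis (Fin n →₀ ℕ) k H) (d : Fin n → ℕ) (r : ℕ) :
    (filtrationLT (pbwFiltration b d) r).comap (pbwFiltration b d r).subtype ≤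
      LinearMap.ker (pbwSymbol b d r ∘ₗ (pbwFiltration b d r).subtype) := by
  rw [filtrationLT_pbwFiltration]
  intro α hα
  exact pbwSymbol_eq_zero (b := b) (d := d) le_rfl (Submodule.mem_comap.1 hα)

/-- The symbol map on a component of the associated graded algebra. -/
noncomputable def grPieceSymbol (b : Module.Basis (Fin n →₀ ℕ) k H) (d : Fin n → ℕ) (r : ℕ) :
    GrPiece (pbwFiltration b d) r →ₗ[k] MvPolynomial (Fin n) k :=
  Submodule.liftQ _ (pbwSymbol b d r ∘ₗ (pbwFiltration b d r).subtype)
    (comap_filtrationLT_le_ker b d r)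

theorem grPieceSymbol_grMk (r : ℕ) (α : pbwFiltration b d r) :
    grPieceSymbol b d r (grMk (pbwFiltration b d) r α) = pbwSymbol b d r α := rfl

/-- An element of `C_r` with zero symbol already lies in `C_{r-1}`. -/
theorem grPieceSymbol_injective (r : ℕ) : Function.Injective (grPieceSymbol b d r) := by
  refine (injective_iff_map_eq_zero _).2 fun y hy => ?_
  obtain ⟨α, rfl⟩ := grMk_surjective (pbwFiltration b d) r y
  rw [grPieceSymbol_grMk] at hy
  rw [grMk_eq_zero, filtrationLT_pbwFiltration]
  exact mem_pbwLT_of_pbwSymbol_eq_zero (mem_pbwFiltration.1 α.2) hy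

theorem IsPBWDeformation.exists_grEquiv (h : IsPBWDeformation b d)
    [IsRingFiltration (pbwFiltration b d) (filtrationLT (pbwFiltration b d))] :
    ∃ e : Gr (pbwFiltration b d) ≃ₐ[k] MvPolynomial (Fin n) k,
      ∀ (r : ℕ) (α : pbwFiltration b d r),
        e (grSymbol (pbwFiltration b d) r α) = pbwSymbol b d r α := by
  classical
  let φ : Gr (pbwFiltration b d) →ₐ[k] MvPolynomial (Fin n) k :=
    DirectSum.toAlgebra k _ (grPieceSymbol b d) (pbwSymbol_zero_one h) (by
      intro r s y z
      obtain ⟨α, rfl⟩ := grMk_surjective (pbwFiltration b d) r y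
      obtain ⟨β, rfl⟩ := grMk_surjective (pbwFiltration b d) s z
      exact h.symbol_mul (mem_pbwFiltration.1 α.2) (mem_pbwFiltration.1 β.2))
  have hof : ∀ r y, φ (DirectSum.of (GrPiece (pbwFiltration b d)) r y) = grPieceSymbol b d r y :=
    fun r y => DirectSum.toAddMonoid_of _ _ _
  have hsymb : ∀ (r : ℕ) (α : pbwFiltration b d r),
      φ (grSymbol (pbwFiltration b d) r α) = pbwSymbol b d r α := fun r α => hof r _
  -- The piece of degree `r` is recovered from the homogeneous component of weight `r`, so
  -- injectivity can be checked piece by piece.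
  have hcomp : ∀ (y : Gr (pbwFiltration b d)) r,
      MvPolynomial.weightedHomogeneousComponent d r (φ y) = grPieceSymbol b d r (y r) := by
    intro y r
    induction y using DirectSum.induction_on with
    | zero => simp
    | add p q hp hq => rw [map_add, map_add, hp, hq, DirectSum.add_apply, map_add]
    | of s y =>
      have hs : (grPieceSymbol b d s y).IsWeightedHomogeneous d s := by
        obtain ⟨α, rfl⟩ := grMk_surjective (pbwFiltration b d) s y
        exact pbwSymbol_isWeightedHomogeneous s _
      rw [hof]
      by_cases hrs : s = r
      · subst hrs
        rw [DirectSum.of_eq_same, hs.weightedHomogeneousComponent_same]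
      · rw [DirectSum.of_eq_of_ne _ _ _ (Ne.symm hrs), map_zero,
          hs.weightedHomogeneousComponent_ne r (Ne.symm hrs)]
  have hinj : Function.Injective φ := by
    intro y z hyz
    refine DFinsupp.ext fun r => grPieceSymbol_injective r ?_
    exact (hcomp y r).symm.trans ((congrArg _ hyz).trans (hcomp z r))
  have hsurj : Function.Surjective φ := by
    rw [← AlgHom.range_eq_top, eq_top_iff, ← MvPolynomial.adjoin_range_X, Algebra.adjoin_le_iff]
    rintro _ ⟨i, rfl⟩
    exact ⟨_, (hsymb (d i) ⟨b (Finsupp.single i 1), mem_pbwFiltration.2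
      (generator_mem_pbwLT i)⟩).trans (pbwSymbol_generator i)⟩
  exact ⟨AlgEquiv.ofBijective φ ⟨hinj, hsurj⟩, hsymb⟩

end Graded

theorem theorem4p3 {k : Type u} [Field k] [IsAlgClosed k] {H : Type v} [Ring H] [HopfAlgebra k H]
    {n : ℕ} (X : Fin n → H) (hX : IsIHOE k X) :
    ∃ b : Module.Basis (Fin n →₀ ℕ) k H, (∀ m, b m = pbwMonomial X m) ∧
      ∃ d : Fin n → ℕ, (∀ i, 0 < d i) ∧
        (∀ α : H, ∃ r, α ∈ pbwFiltration b d r) ∧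
        ∃ _ : IsRingFiltration (pbwFiltration b d) (filtrationLT (pbwFiltration b d)),
        ∃ e : Gr (pbwFiltration b d) ≃ₐ[k] MvPolynomial (Fin n) k,
          (∀ (r : ℕ) (α : pbwFiltration b d r),
            (e (grSymbol (pbwFiltration b d) r α)).IsWeightedHomogeneous d r) ∧
          ∀ i, ∃ hi : X i ∈ pbwFiltration b d (d i),
            e (grSymbol (pbwFiltration b d) (d i) ⟨X i, hi⟩) = MvPolynomial.X i := by
  obtain ⟨b, hb, d, hd, hdef⟩ := hX.exists_pbwDeformation
  have hfilt := hdef.isRingFiltration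
  obtain ⟨e, he⟩ := hdef.exists_grEquiv
  have hgen : ∀ i, b (Finsupp.single i 1) = X i := fun i => by rw [hb, pbwMonomial_single]
  refine ⟨b, hb, d, hd, fun α => ?_, hfilt, e, fun r α => ?_, fun i => ⟨?_, ?_⟩⟩
  · obtain ⟨r, hr⟩ := exists_mem_pbwLT b d α
    exact ⟨r, mem_pbwFiltration.2 hr⟩
  · rw [he]
    exact pbwSymbol_isWeightedHomogeneous r _
  · rw [← hgen, mem_pbwFiltration]
    exact generator_mem_pbwLT i
  · rw [he, ← pbwSymbol_generator (b := b) (d := d) i]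
    exact congrArg _ (hgen i).symm
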